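/- Let $(\Omega,\mathcal F,(\mathcal F_t)_{t\ge 0},\mathbb P)$ be a filtered probability space carrying a standard one-dimensional Brownian motion $B$ relative to $(\mathcal F_t)$: $B$ starts at $0$, has continuous paths, is adapted, and $B(t)-B(s)$ is independent of $\mathcal F_s$ for $s\le t$. Let $T\ge 0$ and $p\in\{1,2\}$. Let $a$ and $\theta$ be real-valued progressively measurable processes such that: * $a$ is locally bounded on $[0,T]$: for every $\epsilon>0$ there is a stopping time $\nu$ with $\mathbb P(\nu<T)<\epsilon$ such that $a(t\wedge\nu)$, $t\in[0,T]$, is almost surely bounded by a deterministic constant; * $\theta(t)>0$ for all $t\in[0,T]$; * almost surely, the function $t\mapsto a(t)/\theta(t)^{p/2}$ is Riemann integrable over $[0,T]$. For $n\ge 1$ define the random grid by $\tau_0^n=0$ and $$\tau_{k+1}^n=\Bigl(\tau_k^n+\frac{1}{n\,\theta(\tau_k^n)}\Bigr)\wedge T,\qquad k\ge 0,$$ let $\eta_n(t)=\sup\{\tau_k^n:\ k\ge 0,\ \tau_k^n\le t\}$ (so that $\eta_n(t)=\tau_k^n$ if $\tau_k^n\le t<\tau_{k+1}^n$), and set $$\psi_n(t)=n^{p/2}\sum_{k=0}^\infty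 a(\tau_k^n)\,\bigl(B(t)-B(\tau_k^n)\bigr)^p\,1_{\{\tau_k^n\le t<\tau_{k+1}^n\}}.$$ Assume that $\eta_n$ tends to the identity in probability, that is, $\eta_n(t)\to t$ in probability as $n\to\infty$ for every $t\in[0,T)$. Put $E_p=\mathbb E\int_0^1 B(s)^p\,ds$. Then $E_1=0$ and $E_2=1/2$; almost surely $\psi_n$ (for every $n$) and $a/\theta^{p/2}$ are Lebesgue integrable over $[0,T]$; and $$\sup_{0\le t\le T}\left|\int_0^t\psi_n(s)\,ds-E_p\int_0^t\frac{a(s)}{\theta(s)^{p/2}}\,ds\right|\longrightarrow 0\quad\text{in probability as } n\to\infty .$$ -/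

import Mathlib

open MeasureTheory ProbabilityTheory Filter Topology
open scoped NNReal ENNReal

noncomputable section

namespace RandomGrid

variable {Ω : Type*} {mΩ : MeasurableSpace Ω}

/-- `B` is a standard one-dimensional Brownian motion relative to the filtration `𝓕`: it has the
finite-dimensional laws of Brownian motion started at `0`, continuous paths, is adapted, and
`B t - B s` is independent of `𝓕 s` for `s ≤ t`. -/
structure IsFilteredBrownian (B : ℝ≥0 → Ω → ℝ) (𝓕 : Filtration ℝ≥0 mΩ) (P : Measure Ω) :
    Prop where
  preBrownian : IsPreBrownianReal B P
  continuous_paths : ∀ ω, Continuous fun t => B t ω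
  adapted : StronglyAdapted 𝓕 B
  indep_increments : ∀ s t : ℝ≥0, s ≤ t →
    Indep (MeasurableSpace.comap (fun ω => B t ω - B s ω) inferInstance) (𝓕 s) P

/-- `a` is locally bounded on `[0, T]`: for every `ε > 0` there is a stopping time `ν` with
`P (ν < T) < ε` such that the stopped process `t ↦ a (t ∧ ν)`, `t ∈ [0, T]`, is bounded by a
deterministic constant (almost surely). -/
def LocallyBoundedOn (a : ℝ≥0 → Ω → ℝ) (𝓕 : Filtration ℝ≥0 mΩ) (P : Measure Ω)
    (T : ℝ≥0) : Prop :=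
  ∀ ε : ℝ≥0∞, 0 < ε → ∃ ν : Ω → WithTop ℝ≥0, IsStoppingTime 𝓕 ν ∧
    P {ω | ν ω < (T : WithTop ℝ≥0)} < ε ∧
    ∃ C : ℝ, ∀ᵐ ω ∂P, ∀ t ≤ T, |a (min (t : WithTop ℝ≥0) (ν ω)).untopA ω| ≤ C

/-- Upper Darboux sum of `f` for the partition points `x 0 ≤ x 1 ≤ … ≤ x m`. -/
def upperSum (f : ℝ → ℝ) (x : ℕ → ℝ) (m : ℕ) : ℝ :=
  ∑ i ∈ Finset.range m, sSup (f '' Set.Icc (x i) (x (i + 1))) * (x (i + 1) - x i)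

/-- Lower Darboux sum of `f` for the partition points `x 0 ≤ x 1 ≤ … ≤ x m`. -/
def lowerSum (f : ℝ → ℝ) (x : ℕ → ℝ) (m : ℕ) : ℝ :=
  ∑ i ∈ Finset.range m, sInf (f '' Set.Icc (x i) (x (i + 1))) * (x (i + 1) - x i)

/-- Riemann integrability of `f` on `[u, v]` (for `u ≤ v`), in Darboux's form: `f` is bounded on
`[u, v]`, and for every `ε > 0` some partition of `[u, v]` has upper and lower sums differing by
less than `ε`. -/
def RiemannIntegrableOn (f : ℝ → ℝ) (u v : ℝ) : Prop :=
  (∃ M : ℝ, ∀ s ∈ Set.Icc u v, |f s| ≤ M) ∧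
    ∀ ε : ℝ, 0 < ε → ∃ (m : ℕ) (x : ℕ → ℝ), Monotone x ∧ x 0 = u ∧ x m = v ∧
      upperSum f x m - lowerSum f x m < ε

/-- The random grid: `τ 0 = 0` and `τ (k+1) = (τ k + 1 / (n θ(τ k))) ∧ T`. -/
def gridPoint (θ : ℝ≥0 → Ω → ℝ) (T : ℝ≥0) (n : ℕ) : ℕ → Ω → ℝ≥0
  | 0, _ => 0
  | k + 1, ω =>
    min (gridPoint θ T n k ω + Real.toNNReal (1 / (n * θ (gridPoint θ T n k ω) ω))) T

/-- `η n t` is the last grid point before or at `t`, that is `η n t = τ k` when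
`τ k ≤ t < τ (k+1)`. -/
def lastGridPoint (θ : ℝ≥0 → Ω → ℝ) (T : ℝ≥0) (n : ℕ) (t : ℝ≥0) (ω : Ω) : ℝ≥0 :=
  sSup {s | s ≤ t ∧ ∃ k, s = gridPoint θ T n k ω}

/-- `ψ n t = n ^ (p/2) * ∑ k, a(τ k) (B t - B (τ k)) ^ p 1_{τ k ≤ t < τ (k+1)}`.
At each `t` at most one term of the series is nonzero. -/
def psi (a θ B : ℝ≥0 → Ω → ℝ) (T : ℝ≥0) (p n : ℕ) (t : ℝ≥0) (ω : Ω) : ℝ :=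
  (n : ℝ) ^ ((p : ℝ) / 2) * ∑' k : ℕ,
    Set.indicator (Set.Ico (gridPoint θ T n k ω) (gridPoint θ T n (k + 1) ω))
      (fun t => a (gridPoint θ T n k ω) ω * (B t ω - B (gridPoint θ T n k ω) ω) ^ p) t

/-- The process `a / θ ^ (p/2)`. -/
def ratio (a θ : ℝ≥0 → Ω → ℝ) (p : ℕ) (t : ℝ≥0) (ω : Ω) : ℝ :=
  a t ω / θ t ω ^ ((p : ℝ) / 2)

/-- `E_p = 𝔼 ∫₀¹ B(s)^p ds`. -/
def meanPower (B : ℝ≥0 → Ω → ℝ) (P : Measure Ω) (p : ℕ) : ℝ :=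
  ∫ ω, (∫ s in (0 : ℝ)..1, B s.toNNReal ω ^ p) ∂P

/-- `sup_{0 ≤ t ≤ T} |X n t - Y t| → 0` in probability as `n → ∞`. The supremum is taken in
`[0, ∞]`. -/
def TendstoUniformlyInProb (P : Measure Ω) (T : ℝ≥0) (X : ℕ → ℝ → Ω → ℝ) (Y : ℝ → Ω → ℝ) :
    Prop :=
  ∀ ε : ℝ≥0∞, 0 < ε →
    Tendsto (fun n => P {ω | ε ≤ ⨆ t ∈ Set.Icc (0 : ℝ) T, ‖X n t ω - Y t ω‖ₑ}) atTop (𝓝 0)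

end RandomGrid

end

noncomputable section

namespace RandomGrid

variable {Ω : Type*} {mΩ : MeasurableSpace Ω}

/-! Write `τ_k` for the grid points and `δ_k` for the cell lengths. Over the `k`-th cell, `ψ_n`
integrates to `n^(p/2) a(τ_k)` times the integral over `[0, δ_k]` of `(B(τ_k + u) - B(τ_k))^p`. By
the strong Markov property (`map_restrict_increment`, `integral_mul_cellIntegral`), its conditional
mean given the past of `τ_k` is `n^(p/2) a(τ_k) E_p δ_k^p`. Since `n θ(τ_k) δ_k = 1` except in cells
cut off at `T`, this is `E_p (a/θ^(p/2))(τ_k) δ_k`: a term of a left-point Riemann sum.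

Three errors remain, each small once the mesh is at most a small `d`. Fluctuations: the compensated
cell integrals are martingale differences. If `a` and `a/θ^(p/2)` are bounded by `C`, their
variances are at most a constant times `C² d E δ_k` (`memLp_compensatedCell`), and these sum to
`O(d)` because the `δ_k` add up to at most `T`. Kolmogorov's maximal inequality controls all partial
sums at once. Times inside a cell: Cauchy–Schwarz bounds the integral over an incomplete cell by
`cellEnergy`, whose expectations also sum to `O(d)`, so a union bound over all cells is affordable.
Riemann sums: for a Riemann integrable path, left-point step functions along every sufficiently fine
grid are uniformly close to it in `L¹`, however the grid depends on `ω`.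

The bounds on `a` and `a/θ^(p/2)` are random, so the weights are cut off on an event known at `τ_k`
(`controlSet`), and the constant `C` is chosen so that the cutoff on these bounds is rarely active.
Convergence of `η_n` at finitely many times makes the mesh small with high probability
(`tendsto_measure_compl_fineGridSet`). The grid may accumulate before `T`; `ψ_n` and the step
function both vanish beyond the limit point, which the `L¹` estimate absorbs. -/

theorem setIntegral_eq_of_indep {P : Measure Ω} [IsProbabilityMeasure P]
    {m₁ m₂ : MeasurableSpace Ω} (h₁ : m₁ ≤ mΩ) (h₂ : m₂ ≤ mΩ) (h : Indep m₁ m₂ P) {g : Ω → ℝ}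
    (hg : StronglyMeasurable[m₁] g) (hgi : Integrable g P) {A : Set Ω}
    (hA : MeasurableSet[m₂] A) : ∫ ω in A, g ω ∂P = P.real A * ∫ ω, g ω ∂P := by
  have hc := condExp_indep_eq h₁ h₂ hg h
  rw [← setIntegral_condExp h₂ hgi hA, setIntegral_congr_ae (h₂ _ hA) (hc.mono fun ω h _ => h)]
  simp

/-! ### Measurability of Brownian motion and finite stopping times -/

theorem IsFilteredBrownian.measurable {B : ℝ≥0 → Ω → ℝ} {𝓕 : Filtration ℝ≥0 mΩ} {P : Measure Ω}
    (hB : IsFilteredBrownian B 𝓕 P) (t : ℝ≥0) : Measurable (B t) :=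
  ((hB.adapted t).mono (𝓕.le t)).measurable

theorem IsFilteredBrownian.measurable_uncurry {B : ℝ≥0 → Ω → ℝ} {𝓕 : Filtration ℝ≥0 mΩ}
    {P : Measure Ω} (hB : IsFilteredBrownian B 𝓕 P) :
    Measurable (fun q : ℝ≥0 × Ω => B q.1 q.2) :=
  (stronglyMeasurable_uncurry_of_continuous_of_stronglyMeasurable hB.continuous_paths
    fun t => (hB.measurable t).stronglyMeasurable).measurable

theorem IsFilteredBrownian.progressive {B : ℝ≥0 → Ω → ℝ} {𝓕 : Filtration ℝ≥0 mΩ}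
    {P : Measure Ω} (hB : IsFilteredBrownian B 𝓕 P) : IsStronglyProgressive 𝓕 B :=
  hB.adapted.isStronglyProgressive_of_continuous hB.continuous_paths

/-- `τ` is a finite stopping time. -/
abbrev IsFiniteStopping (𝓕 : Filtration ℝ≥0 mΩ) (τ : Ω → ℝ≥0) : Prop :=
  IsStoppingTime 𝓕 (fun ω => (τ ω : WithTop ℝ≥0))

theorem IsFiniteStopping.measurable_self {𝓕 : Filtration ℝ≥0 mΩ} {τ : Ω → ℝ≥0}
    (hτ : IsFiniteStopping 𝓕 τ) : Measurable[hτ.measurableSpace] τ := by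
  exact (IsStoppingTime.measurable hτ).untopA

theorem IsFiniteStopping.measurable_value {𝓕 : Filtration ℝ≥0 mΩ} {τ : Ω → ℝ≥0}
    (hτ : IsFiniteStopping 𝓕 τ) {u : ℝ≥0 → Ω → ℝ} (hu : IsStronglyProgressive 𝓕 u) :
    Measurable[hτ.measurableSpace] (fun ω => u (τ ω) ω) := by
  exact measurable_stoppedValue hu hτ

/-- The event `τ + Z ≤ i` lies in the past of `τ` and is contained in `τ ≤ i`, hence belongs to `𝓕
i`. -/
theorem IsFiniteStopping.add {𝓕 : Filtration ℝ≥0 mΩ} {τ : Ω → ℝ≥0}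
    (hτ : IsFiniteStopping 𝓕 τ) {Z : Ω → ℝ≥0} (hZ : Measurable[hτ.measurableSpace] Z) :
    IsFiniteStopping 𝓕 (fun ω => τ ω + Z ω) := by
  intro i
  have key : ∀ {m : MeasurableSpace Ω}, Measurable[m] τ → Measurable[m] Z →
      MeasurableSet[m] {ω | τ ω + Z ω ≤ i} :=
    fun h1 h2 => measurableSet_le (h1.add h2) measurable_const
  have h1 : MeasurableSet[hτ.measurableSpace] {ω | τ ω + Z ω ≤ i} :=
    key hτ.measurable_self hZ
  have h2 := h1.2 i
  convert h2 using 1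
  ext ω
  simp only [Set.mem_ofPred_eq, Set.mem_inter_iff]
  norm_cast
  exact ⟨fun h => ⟨h, le_self_add.trans h⟩, fun h => h.1⟩

/-- The smallest multiple of `1 / (m + 1)` strictly greater than `x`. -/
def ceilApprox (m : ℕ) (x : ℝ≥0) : ℝ≥0 := (⌊(m + 1) * x⌋₊ + 1) / (m + 1)

theorem tendsto_ceilApprox (x : ℝ≥0) : Tendsto (fun m => ceilApprox m x) atTop (𝓝 x) := by
  have h1 : ∀ m, x ≤ ceilApprox m x := fun m => by
    rw [ceilApprox, le_div_iff₀ (by positivity), mul_comm]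
    exact (Nat.lt_floor_add_one _).le
  have h2 : ∀ m, ceilApprox m x ≤ x + 1 / ((m : ℝ≥0) + 1) := fun m => by
    rw [ceilApprox, div_le_iff₀ (by positivity), add_mul x, one_div,
      inv_mul_cancel₀ (by positivity), mul_comm x]
    gcongr
    exact Nat.floor_le (by positivity)
  refine tendsto_of_tendsto_of_tendsto_of_le_of_le tendsto_const_nhds ?_ h1 h2
  simpa using (tendsto_const_nhds (x := x)).add
    (tendsto_one_div_add_atTop_nhds_zero_nat (𝕜 := ℝ≥0))

theorem ceilApprox_eq_iff (m j : ℕ) (x : ℝ≥0) :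
    ⌊(m + 1) * x⌋₊ = j ↔ ¬ x < (j : ℝ≥0) / (m + 1) ∧ x < ((j : ℝ≥0) + 1) / (m + 1) := by
  rw [Nat.floor_eq_iff (by positivity), not_lt, div_le_iff₀ (by positivity),
    lt_div_iff₀ (by positivity), mul_comm x]

/-- On this event `ceilApprox m τ` equals the deterministic time `(j + 1) / (m + 1)`, at which the
event is already known; the independence of increments after that time then applies. -/
theorem measurableSet_inter_floor {𝓕 : Filtration ℝ≥0 mΩ} {τ : Ω → ℝ≥0}
    (hτ : IsFiniteStopping 𝓕 τ) {A : Set Ω} (hA : MeasurableSet[hτ.measurableSpace] A)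
    (m j : ℕ) :
    MeasurableSet[𝓕 (((j : ℝ≥0) + 1) / (m + 1))]
      (A ∩ {ω | ⌊(m + 1) * τ ω⌋₊ = j}) := by
  have h1 := hA.2 (((j : ℝ≥0) + 1) / (m + 1))
  have h2 := hτ.measurableSet_lt (((j : ℝ≥0) + 1) / (m + 1))
  have h3 := hτ.measurableSet_lt_le
    (show (j : ℝ≥0) / (m + 1) ≤ ((j : ℝ≥0) + 1) / (m + 1) by gcongr; simp)
  convert (h1.inter h2).diff h3 using 1
  ext ω
  simp only [Set.mem_inter_iff, Set.mem_ofPred_eq, Set.mem_sdiff, ceilApprox_eq_iff]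
  norm_cast
  constructor
  · rintro ⟨a, b, c⟩
    exact ⟨⟨⟨a, c.le⟩, c⟩, b⟩
  · rintro ⟨⟨⟨a, _⟩, c⟩, b⟩
    exact ⟨a, b, c⟩

/-! ### The strong Markov property at a finite stopping time -/

section StrongMarkov

variable {P : Measure Ω} {𝓕 : Filtration ℝ≥0 mΩ} {B : ℝ≥0 → Ω → ℝ} {τ : Ω → ℝ≥0}

theorem integral_increment (hB : IsFilteredBrownian B 𝓕 P) (t s : ℝ≥0)
    (f : BoundedContinuousFunction ℝ ℝ) :
    ∫ ω, f (B (t + s) ω - B t ω) ∂P = ∫ x, f x ∂(gaussianReal 0 s) := by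
  have h := hB.preBrownian.hasLaw_sub (t + s) t
  have hd : nndist ((t + s : ℝ≥0) : ℝ) (t : ℝ) = s := by
    ext
    simp
  rw [show nndist (t + s).1 t.1 = s from hd] at h
  rw [← h.map_eq, integral_map h.aemeasurable f.continuous.aestronglyMeasurable]
  rfl

variable [IsProbabilityMeasure P]

/-- Strong Markov for a stopping time with countably many values: split `A` according to the value
and use the independence of increments on each piece. -/
theorem setIntegral_ceilApprox_increment (hB : IsFilteredBrownian B 𝓕 P)
    (hτ : IsFiniteStopping 𝓕 τ) (s : ℝ≥0) {A : Set Ω} (hA : MeasurableSet[hτ.measurableSpace] A)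
    (f : BoundedContinuousFunction ℝ ℝ) (m : ℕ) :
    ∫ ω in A, f (B (ceilApprox m (τ ω) + s) ω - B (ceilApprox m (τ ω)) ω) ∂P =
      P.real A * ∫ x, f x ∂(gaussianReal 0 s) := by
  set Aj : ℕ → Set Ω := fun j => A ∩ {ω | ⌊(m + 1) * τ ω⌋₊ = j} with hAj
  have hU : A = ⋃ j, Aj j := by ext ω; simp [hAj]
  have hm : ∀ j, MeasurableSet (Aj j) := fun j =>
    𝓕.le _ _ (measurableSet_inter_floor hτ hA m j)
  have hd : Pairwise (Function.onFun Disjoint Aj) := by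
    intro i j hij
    rw [Function.onFun, Set.disjoint_left]
    rintro ω ⟨_, h1⟩ ⟨_, h2⟩
    exact hij (h1.symm.trans h2)
  have hτm : Measurable τ := hτ.measurable_self.mono hτ.measurableSpace_le le_rfl
  have hcm : Measurable fun ω => ceilApprox m (τ ω) := by
    unfold ceilApprox
    have : Measurable fun ω => ⌊((m : ℝ≥0) + 1) * τ ω⌋₊ :=
      Nat.measurable_floor.comp (hτm.const_mul _)
    have h2 : Measurable fun n : ℕ => ((n : ℝ≥0) + 1) / (m + 1) := measurable_from_nat
    exact h2.comp this
  have hWm : Measurable fun ω => B (ceilApprox m (τ ω) + s) ω - B (ceilApprox m (τ ω)) ω :=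
    (hB.measurable_uncurry.comp ((hcm.add_const s).prodMk measurable_id)).sub
      (hB.measurable_uncurry.comp (hcm.prodMk measurable_id))
  have hint : Integrable
      (fun ω => f (B (ceilApprox m (τ ω) + s) ω - B (ceilApprox m (τ ω)) ω)) P :=
    Integrable.of_bound (f.continuous.measurable.comp hWm).aestronglyMeasurable ‖f‖
      (ae_of_all _ fun ω => f.norm_coe_le_norm _)
  have hj : ∀ j, ∫ ω in Aj j, f (B (ceilApprox m (τ ω) + s) ω - B (ceilApprox m (τ ω)) ω) ∂P =
      P.real (Aj j) * ∫ x, f x ∂(gaussianReal 0 s) := by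
    intro j
    set t : ℝ≥0 := ((j : ℝ≥0) + 1) / (m + 1) with ht
    have h1 : ∫ ω in Aj j, f (B (ceilApprox m (τ ω) + s) ω - B (ceilApprox m (τ ω)) ω) ∂P =
        ∫ ω in Aj j, f (B (t + s) ω - B t ω) ∂P := by
      refine setIntegral_congr_fun (hm j) fun ω hω => ?_
      have : ceilApprox m (τ ω) = t := by
        have h := hω.2
        simp only [Set.mem_ofPred_eq] at h
        simp [ceilApprox, h, ht]
      simp only [this]
    have hincm : Measurable fun ω => B (t + s) ω - B t ω :=
      (hB.measurable _).sub (hB.measurable _)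
    rw [h1, setIntegral_eq_of_indep hincm.comap_le (𝓕.le t)
      (hB.indep_increments t (t + s) le_self_add) (g := fun ω => f (B (t + s) ω - B t ω))
      ((f.continuous.measurable.comp (comap_measurable _)).stronglyMeasurable)
      (Integrable.of_bound (f.continuous.measurable.comp hincm).aestronglyMeasurable ‖f‖
        (ae_of_all _ fun ω => f.norm_coe_le_norm _)) (measurableSet_inter_floor hτ hA m j),
      integral_increment hB]
  have hs1 := hasSum_integral_iUnion hm hd (hint.integrableOn (s := ⋃ j, Aj j))
  simp_rw [hj] at hs1
  have hs2 : HasSum (fun j => P.real (Aj j)) (P.real (⋃ j, Aj j)) := by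
    simpa using hasSum_integral_iUnion (f := fun _ => (1 : ℝ)) (μ := P) hm hd
      (integrable_const _).integrableOn
  rw [← hU] at hs1 hs2
  exact hs1.unique (hs2.mul_right _)

/-- The strong Markov property: restricted to an event of the past of `τ`, the increment of `B`
after `τ` has a centred Gaussian law. -/
theorem map_restrict_increment (hB : IsFilteredBrownian B 𝓕 P) (hτ : IsFiniteStopping 𝓕 τ)
    (s : ℝ≥0) {A : Set Ω} (hA : MeasurableSet[hτ.measurableSpace] A) :
    (P.restrict A).map (fun ω => B (τ ω + s) ω - B (τ ω) ω) = P A • gaussianReal 0 s := by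
  have hτm : Measurable τ := hτ.measurable_self.mono hτ.measurableSpace_le le_rfl
  have hWm : Measurable fun ω => B (τ ω + s) ω - B (τ ω) ω :=
    (hB.measurable_uncurry.comp ((hτm.add_const s).prodMk measurable_id)).sub
      (hB.measurable_uncurry.comp (hτm.prodMk measurable_id))
  have : IsFiniteMeasure (P A • gaussianReal 0 s) :=
    Measure.smul_finite _ (measure_ne_top _ _)
  refine ext_of_forall_integral_eq_of_IsFiniteMeasure fun f => ?_
  rw [integral_map hWm.aemeasurable f.continuous.aestronglyMeasurable, integral_smul_measure]
  -- Path continuity carries the identity from the discretised times to `τ`; bounded continuous test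
  -- functions make dominated convergence immediate.
  have hlim : Tendsto (fun m : ℕ =>
      ∫ ω in A, f (B (ceilApprox m (τ ω) + s) ω - B (ceilApprox m (τ ω)) ω) ∂P) atTop
      (𝓝 (∫ ω in A, f (B (τ ω + s) ω - B (τ ω) ω) ∂P)) := by
    refine tendsto_integral_of_dominated_convergence (fun _ => ‖f‖) (fun m => ?_)
      (integrable_const _) (fun m => ae_of_all _ fun ω => f.norm_coe_le_norm _)
      (ae_of_all _ fun ω => ?_)
    · have hcm : Measurable fun ω => ceilApprox m (τ ω) := by
        unfold ceilApprox
        have : Measurable fun ω => ⌊((m : ℝ≥0) + 1) * τ ω⌋₊ :=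
          Nat.measurable_floor.comp (hτm.const_mul _)
        have h2 : Measurable fun n : ℕ => ((n : ℝ≥0) + 1) / (m + 1) := measurable_from_nat
        exact h2.comp this
      exact (f.continuous.measurable.comp
        ((hB.measurable_uncurry.comp ((hcm.add_const s).prodMk measurable_id)).sub
        (hB.measurable_uncurry.comp (hcm.prodMk measurable_id)))).aestronglyMeasurable
    · have h := tendsto_ceilApprox (τ ω)
      exact (f.continuous.tendsto _).comp
        ((((hB.continuous_paths ω).tendsto _).comp (h.add_const s)).sub
          (((hB.continuous_paths ω).tendsto _).comp h))
  have hc : (fun m : ℕ =>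
      ∫ ω in A, f (B (ceilApprox m (τ ω) + s) ω - B (ceilApprox m (τ ω)) ω) ∂P) =
      fun _ => P.real A * ∫ x, f x ∂(gaussianReal 0 s) :=
    funext fun m => setIntegral_ceilApprox_increment hB hτ s hA f m
  rw [hc] at hlim
  exact tendsto_nhds_unique hlim tendsto_const_nhds

theorem hasLaw_increment (hB : IsFilteredBrownian B 𝓕 P) (hτ : IsFiniteStopping 𝓕 τ)
    (s : ℝ≥0) : HasLaw (fun ω => B (τ ω + s) ω - B (τ ω) ω) (gaussianReal 0 s) P where
  aemeasurable := by
    have hτm : Measurable τ := hτ.measurable_self.mono hτ.measurableSpace_le le_rfl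
    exact ((hB.measurable_uncurry.comp ((hτm.add_const s).prodMk measurable_id)).sub
      (hB.measurable_uncurry.comp (hτm.prodMk measurable_id))).aemeasurable
  map_eq := by
    have := map_restrict_increment hB hτ s (@MeasurableSet.univ _ hτ.measurableSpace)
    simpa using this

theorem indepFun_increment (hB : IsFilteredBrownian B 𝓕 P) (hτ : IsFiniteStopping 𝓕 τ)
    (s : ℝ≥0) {X : Ω → ℝ} (hX : Measurable[hτ.measurableSpace] X) :
    IndepFun X (fun ω => B (τ ω + s) ω - B (τ ω) ω) P := by
  have hτm : Measurable τ := hτ.measurable_self.mono hτ.measurableSpace_le le_rfl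
  have hWm : Measurable fun ω => B (τ ω + s) ω - B (τ ω) ω :=
    (hB.measurable_uncurry.comp ((hτm.add_const s).prodMk measurable_id)).sub
      (hB.measurable_uncurry.comp (hτm.prodMk measurable_id))
  rw [indepFun_iff_measure_inter_preimage_eq_mul]
  intro S U hS hU
  have h1 := congrArg (fun μ : Measure ℝ => μ U) (map_restrict_increment hB hτ s (hX hS))
  have h2 := (hasLaw_increment hB hτ s).map_eq
  simp only [Measure.map_apply hWm hU, Measure.restrict_apply (hWm hU), Measure.smul_apply,
    smul_eq_mul] at h1
  rw [← h2, Measure.map_apply hWm hU] at h1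
  rw [Set.inter_comm]
  exact h1

end StrongMarkov

/-! ### Moments of the centred Gaussian law -/

/-- The `q`-th moment of the centred Gaussian law of variance `s`. -/
def gaussMoment (q : ℕ) (s : ℝ≥0) : ℝ := ∫ x, x ^ q ∂(gaussianReal 0 s)

theorem gaussMoment_scale (q : ℕ) (s : ℝ≥0) :
    gaussMoment q s = √s ^ q * gaussMoment q 1 := by
  have h := gaussianReal_map_const_mul (μ := 0) (v := 1) (√(s : ℝ))
  have hv : NNReal.mk (√(s : ℝ) ^ 2) (sq_nonneg _) * 1 = s := by
    ext
    simp
  rw [mul_zero, hv] at h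
  unfold gaussMoment
  rw [← h, integral_map (by fun_prop) (by fun_prop), ← integral_const_mul]
  simp_rw [mul_pow]

theorem gaussMoment_one (s : ℝ≥0) : gaussMoment 1 s = 0 := by
  simp [gaussMoment]

theorem gaussMoment_two (s : ℝ≥0) : gaussMoment 2 s = s := by
  have h := variance_fun_id_gaussianReal (μ := 0) (v := s)
  rw [variance_eq_integral (by fun_prop)] at h
  simpa [gaussMoment] using h

theorem gaussMoment_two_mul (p : ℕ) (s : ℝ≥0) :
    gaussMoment (2 * p) s = (s : ℝ) ^ p * gaussMoment (2 * p) 1 := by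
  rw [gaussMoment_scale, pow_mul, Real.sq_sqrt s.coe_nonneg]

theorem gaussMoment_two_mul_nonneg (p : ℕ) (s : ℝ≥0) : 0 ≤ gaussMoment (2 * p) s :=
  integral_nonneg fun x => by simp only [pow_mul, Pi.zero_apply]; positivity

theorem integrable_pow_gaussianReal (q : ℕ) (s : ℝ≥0) :
    Integrable (fun x : ℝ => x ^ q) (gaussianReal 0 s) := by
  have h := memLp_id_gaussianReal (μ := 0) (v := s) (q : ℝ≥0)
  rcases Nat.eq_zero_or_pos q with rfl | hq
  · simp
  · have := h.integrable_norm_pow (by positivity)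
    refine (this.mono' (by fun_prop) (ae_of_all _ fun x => ?_))
    simp

theorem continuous_gaussMoment (q : ℕ) : Continuous (gaussMoment q) := by
  have : gaussMoment q = fun s : ℝ≥0 => √(s : ℝ) ^ q * gaussMoment q 1 :=
    funext fun s => gaussMoment_scale q s
  rw [this]
  fun_prop

/-! ### Integrals of powers of Brownian increments over random cells -/

theorem intervalIntegral_eq_setIntegral_indicator {d T : ℝ} (hd : 0 ≤ d) (hdT : d ≤ T)
    (g : ℝ → ℝ) :
    ∫ u in (0 : ℝ)..d, g u = ∫ u in Set.Ioc 0 T, (Set.Iic d).indicator g u := by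
  rw [intervalIntegral.integral_of_le hd, setIntegral_indicator measurableSet_Iic]
  congr 2
  ext u
  simp only [Set.mem_Ioc, Set.mem_inter_iff, Set.mem_Iic]
  exact ⟨fun h => ⟨⟨h.1, h.2.trans hdT⟩, h.2⟩, fun h => ⟨h.1.1, h.2⟩⟩

theorem measurable_intervalIntegral_upper {Ω : Type*} {m : MeasurableSpace Ω} {d : Ω → ℝ≥0}
    {T : ℝ≥0} (hd : Measurable d) (hdT : ∀ ω, d ω ≤ T) {Y : ℝ → Ω → ℝ}
    (hY : Measurable (Function.uncurry Y)) :
    Measurable fun ω => ∫ u in (0 : ℝ)..d ω, Y u ω := by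
  have : (fun ω => ∫ u in (0 : ℝ)..d ω, Y u ω) = fun ω => ∫ u in Set.Ioc 0 (T : ℝ),
      {q : ℝ × Ω | q.1 ≤ d q.2}.indicator (Function.uncurry Y) (u, ω) := by
    funext ω
    rw [intervalIntegral_eq_setIntegral_indicator (d ω).coe_nonneg (by exact_mod_cast hdT ω)]
    rfl
  rw [this]
  refine (StronglyMeasurable.integral_prod_left' ?_).measurable
  exact (hY.indicator (measurableSet_le measurable_fst
    (hd.coe_nnreal_real.comp measurable_snd))).stronglyMeasurable

/-- Cauchy–Schwarz against the constant `1`, obtained by expanding the integral of the squared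
deviation of `g` from its mean. The right side does not involve `t`, so one quantity controls the
primitive throughout a cell. -/
theorem sq_intervalIntegral_le {g : ℝ → ℝ} (hg : Continuous g) {t d : ℝ} (ht : 0 ≤ t)
    (htd : t ≤ d) : (∫ u in (0 : ℝ)..t, g u) ^ 2 ≤ d * ∫ u in (0 : ℝ)..d, g u ^ 2 := by
  have h1 : (∫ u in (0 : ℝ)..t, g u) ^ 2 ≤ t * ∫ u in (0 : ℝ)..t, g u ^ 2 := by
    rcases ht.eq_or_lt with rfl | ht'
    · simp
    set I := ∫ u in (0 : ℝ)..t, g u with hI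
    have hnn : 0 ≤ ∫ u in (0 : ℝ)..t, (g u - I / t) ^ 2 :=
      intervalIntegral.integral_nonneg ht fun u _ => sq_nonneg _
    have he : ∫ u in (0 : ℝ)..t, (g u - I / t) ^ 2 =
        (∫ u in (0 : ℝ)..t, g u ^ 2) - I ^ 2 / t := by
      have : ∀ u, (g u - I / t) ^ 2 = g u ^ 2 - (2 * (I / t)) * g u + (I / t) ^ 2 := fun u => by
        ring
      simp_rw [this]
      rw [intervalIntegral.integral_add (Continuous.intervalIntegrable (by fun_prop) _ _)
          (Continuous.intervalIntegrable (by fun_prop) _ _),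
        intervalIntegral.integral_sub (Continuous.intervalIntegrable (by fun_prop) _ _)
          (Continuous.intervalIntegrable (by fun_prop) _ _),
        intervalIntegral.integral_const_mul, intervalIntegral.integral_const, ← hI]
      simp only [smul_eq_mul]
      field_simp
      ring
    rw [he, sub_nonneg, div_le_iff₀ ht'] at hnn
    linarith
  have hnn : ∀ x y : ℝ, x ≤ y → 0 ≤ ∫ u in x..y, g u ^ 2 := fun x y h =>
    intervalIntegral.integral_nonneg h fun u _ => sq_nonneg _
  have h2 : ∫ u in (0 : ℝ)..t, g u ^ 2 ≤ ∫ u in (0 : ℝ)..d, g u ^ 2 := by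
    rw [← intervalIntegral.integral_add_adjacent_intervals (a := 0) (b := t) (c := d)
      (Continuous.intervalIntegrable (by fun_prop) _ _)
      (Continuous.intervalIntegrable (by fun_prop) _ _)]
    linarith [hnn t d htd]
  calc _ ≤ _ := h1
    _ ≤ d * ∫ u in (0 : ℝ)..t, g u ^ 2 := mul_le_mul_of_nonneg_right htd (hnn 0 t ht)
    _ ≤ _ := mul_le_mul_of_nonneg_left h2 (ht.trans htd)

/-- `∫₀^δ (B(τ + u) - B(τ))^q du`. -/
def cellIntegral (B : ℝ≥0 → Ω → ℝ) (q : ℕ) (τ δ : Ω → ℝ≥0) (ω : Ω) : ℝ :=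
  ∫ u in (0 : ℝ)..δ ω, (B (τ ω + u.toNNReal) ω - B (τ ω) ω) ^ q

section CellIntegral

variable {P : Measure Ω} {𝓕 : Filtration ℝ≥0 mΩ} {B : ℝ≥0 → Ω → ℝ} {τ δ : Ω → ℝ≥0} {T : ℝ≥0}

theorem measurable_uncurry_increment (hB : IsFilteredBrownian B 𝓕 P) (hτ : Measurable τ) :
    Measurable (Function.uncurry
      fun (u : ℝ) ω => B (τ ω + u.toNNReal) ω - B (τ ω) ω) := by
  have h1 : Measurable fun q : ℝ × Ω => (τ q.2 + q.1.toNNReal, q.2) :=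
    ((hτ.comp measurable_snd).add measurable_fst.real_toNNReal).prodMk measurable_snd
  have h2 : Measurable fun q : ℝ × Ω => (τ q.2, q.2) :=
    (hτ.comp measurable_snd).prodMk measurable_snd
  exact (hB.measurable_uncurry.comp h1).sub (hB.measurable_uncurry.comp h2)

theorem continuous_increment (hB : IsFilteredBrownian B 𝓕 P) (t : ℝ≥0) (ω : Ω) :
    Continuous fun u : ℝ => B (t + u.toNNReal) ω - B t ω :=
  ((hB.continuous_paths ω).comp (continuous_const.add continuous_real_toNNReal)).sub
    continuous_const

/-- Replacing `u` by `min u δ` leaves the integral unchanged and makes every evaluation time a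
stopping time not later than `σ`, so the integrand is known at `σ` for every `u`. -/
theorem measurable_cellIntegral (hB : IsFilteredBrownian B 𝓕 P) (hτ : IsFiniteStopping 𝓕 τ)
    (hδ : Measurable[hτ.measurableSpace] δ) (hδT : ∀ ω, δ ω ≤ T) {σ : Ω → ℝ≥0}
    (hσ : IsFiniteStopping 𝓕 σ) (hστ : ∀ ω, σ ω = τ ω + δ ω) (q : ℕ) :
    Measurable[hσ.measurableSpace] (cellIntegral B q τ δ) := by
  have hmono : hτ.measurableSpace ≤ hσ.measurableSpace :=
    IsStoppingTime.measurableSpace_mono hτ hσ fun ω => by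
      simp only [hστ]
      exact_mod_cast le_self_add
  have hpt : ∀ u : ℝ, StronglyMeasurable[hσ.measurableSpace]
      fun ω => (B (τ ω + min u.toNNReal (δ ω)) ω - B (τ ω) ω) ^ q := by
    intro u
    have key : ∀ {m : MeasurableSpace Ω}, Measurable[m] δ →
      Measurable[m] fun ω => min u.toNNReal (δ ω) := fun h => measurable_const.min h
    have hρ : IsFiniteStopping 𝓕 fun ω => τ ω + min u.toNNReal (δ ω) := hτ.add (key hδ)
    have hρσ : hρ.measurableSpace ≤ hσ.measurableSpace :=
      IsStoppingTime.measurableSpace_mono hρ hσ fun ω => by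
        simp only [hστ]
        exact_mod_cast add_le_add_right (min_le_right _ _) _
    have h1 := (hρ.measurable_value hB.progressive).mono hρσ le_rfl
    have h2 := (hτ.measurable_value hB.progressive).mono hmono le_rfl
    have key2 : ∀ {m : MeasurableSpace Ω} {x y : Ω → ℝ}, Measurable[m] x → Measurable[m] y →
      StronglyMeasurable[m] fun ω => (x ω - y ω) ^ q :=
        fun hx hy => ((hx.sub hy).pow_const q).stronglyMeasurable
    exact key2 h1 h2
  have heq : cellIntegral B q τ δ = fun ω =>
      ∫ u in (0 : ℝ)..δ ω, (B (τ ω + min u.toNNReal (δ ω)) ω - B (τ ω) ω) ^ q := by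
    funext ω
    refine intervalIntegral.integral_congr fun u hu => ?_
    rw [Set.uIcc_of_le (δ ω).coe_nonneg] at hu
    rw [min_eq_left (Real.toNNReal_le_iff_le_coe.mpr hu.2)]
  rw [heq]
  have hjoint := (@stronglyMeasurable_uncurry_of_continuous_of_stronglyMeasurable Ω ℝ ℝ _ _ _ _ _
    _ _ hσ.measurableSpace
    (fun u ω => (B (τ ω + min u.toNNReal (δ ω)) ω - B (τ ω) ω) ^ q) (fun ω => by
      refine (((hB.continuous_paths ω).comp ?_).sub continuous_const).pow q
      exact continuous_const.add (continuous_real_toNNReal.min continuous_const)) hpt).measurable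
  exact @measurable_intervalIntegral_upper Ω hσ.measurableSpace δ T (hδ.mono hmono le_rfl) hδT _
    hjoint

variable [IsProbabilityMeasure P]

theorem integral_increment_pow (hB : IsFilteredBrownian B 𝓕 P) (hτ : IsFiniteStopping 𝓕 τ)
    (q : ℕ) (s : ℝ≥0) : Integrable (fun ω => (B (τ ω + s) ω - B (τ ω) ω) ^ q) P ∧
    ∫ ω, (B (τ ω + s) ω - B (τ ω) ω) ^ q ∂P = gaussMoment q s := by
  have h := hasLaw_increment hB hτ s
  constructor
  · have := integrable_pow_gaussianReal q s
    rw [← h.map_eq] at this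
    exact this.comp_aemeasurable h.aemeasurable
  · rw [gaussMoment, ← h.map_eq, integral_map h.aemeasurable (by fun_prop)]

theorem integrable_increment_pow_prod (hB : IsFilteredBrownian B 𝓕 P)
    (hτ : IsFiniteStopping 𝓕 τ) (T : ℝ≥0) (q : ℕ) :
    Integrable (fun z : ℝ × Ω => (B (τ z.2 + z.1.toNNReal) z.2 - B (τ z.2) z.2) ^ q)
      ((volume.restrict (Set.Ioc 0 (T : ℝ))).prod P) := by
  have hτm : Measurable τ := hτ.measurable_self.mono hτ.measurableSpace_le le_rfl
  have hm : ∀ q : ℕ, Measurable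
      fun z : ℝ × Ω => (B (τ z.2 + z.1.toNNReal) z.2 - B (τ z.2) z.2) ^ q := fun q =>
    (measurable_uncurry_increment hB hτm).pow_const q
  have heven : ∀ p : ℕ, Integrable
      (fun z : ℝ × Ω => (B (τ z.2 + z.1.toNNReal) z.2 - B (τ z.2) z.2) ^ (2 * p))
      ((volume.restrict (Set.Ioc 0 (T : ℝ))).prod P) := by
    intro p
    rw [integrable_prod_iff (hm _).aestronglyMeasurable]
    refine ⟨ae_of_all _ fun u => (integral_increment_pow hB hτ (2 * p) u.toNNReal).1, ?_⟩
    have : (fun u : ℝ => ∫ ω, ‖(B (τ ω + u.toNNReal) ω - B (τ ω) ω) ^ (2 * p)‖ ∂P) =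
        fun u => gaussMoment (2 * p) u.toNNReal := by
      funext u
      rw [← (integral_increment_pow hB hτ (2 * p) u.toNNReal).2]
      refine integral_congr_ae (ae_of_all _ fun ω => ?_)
      simp only
      rw [Real.norm_of_nonneg]
      rw [pow_mul]
      positivity
    rw [this]
    exact (((continuous_gaussMoment _).comp continuous_real_toNNReal).integrableOn_Icc
      (a := 0) (b := (T : ℝ))).mono_set Set.Ioc_subset_Icc_self
  have hc : Integrable (fun _ : ℝ × Ω => (1 : ℝ))
      ((volume.restrict (Set.Ioc 0 (T : ℝ))).prod P) := integrable_const _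
  -- Even powers are nonnegative and are handled by Tonelli; a general power follows from `|y| ≤ 1 +
  -- y²` with `y = x ^ q`.
  refine (hc.add (heven q)).mono' (hm q).aestronglyMeasurable (ae_of_all _ fun z => ?_)
  simp only [Pi.add_apply]
  set x := B (τ z.2 + z.1.toNNReal) z.2 - B (τ z.2) z.2
  rw [mul_comm, pow_mul, ← sq_abs (x ^ q), Real.norm_eq_abs]
  nlinarith [sq_nonneg (|x ^ q| - 1), abs_nonneg (x ^ q)]

/-- Moving `δ` into the indicator of `u ≤ δ` fixes the domain of integration. For fixed `u` the
factor `X 1_{u ≤ δ}` belongs to the past of `τ`, hence is independent of the increment, and Fubini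
concludes. -/
theorem integral_mul_cellIntegral (hB : IsFilteredBrownian B 𝓕 P) (hτ : IsFiniteStopping 𝓕 τ)
    (hδ : Measurable[hτ.measurableSpace] δ) (hδT : ∀ ω, δ ω ≤ T) (q : ℕ) {X : Ω → ℝ}
    (hX : Measurable[hτ.measurableSpace] X) {K : ℝ} (hXK : ∀ ω, |X ω| ≤ K) :
    Integrable (fun ω => X ω * cellIntegral B q τ δ ω) P ∧
    ∫ ω, X ω * cellIntegral B q τ δ ω ∂P =
      ∫ ω, X ω * (∫ u in (0 : ℝ)..δ ω, gaussMoment q u.toNNReal) ∂P := by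
  have hle := hτ.measurableSpace_le
  have hτm : Measurable τ := hτ.measurable_self.mono hle le_rfl
  have hδm : Measurable δ := hδ.mono hle le_rfl
  have hXm : Measurable X := hX.mono hle le_rfl
  set μ := volume.restrict (Set.Ioc 0 (T : ℝ)) with hμ
  set Y : ℝ → Ω → ℝ := fun u ω => if u ≤ δ ω then X ω else 0 with hY
  have hYm : Measurable (Function.uncurry Y) :=
    Measurable.ite (measurableSet_le measurable_fst (hδm.coe_nnreal_real.comp measurable_snd))
      (hXm.comp measurable_snd) measurable_const
  have hYK : ∀ u ω, |Y u ω| ≤ K := fun u ω => by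
    simp only [hY]
    split_ifs
    · exact hXK ω
    · simpa using (abs_nonneg _).trans (hXK ω)
  have hrep : ∀ (g : ℝ → ℝ) (ω : Ω), X ω * ∫ u in (0 : ℝ)..δ ω, g u =
      ∫ u, Y u ω * g u ∂μ := by
    intro g ω
    rw [intervalIntegral_eq_setIntegral_indicator (δ ω).coe_nonneg (by exact_mod_cast hδT ω),
      ← integral_const_mul]
    refine integral_congr_ae (ae_of_all _ fun u => ?_)
    by_cases h : u ≤ δ ω <;> simp [hY, h]
  have hW := integrable_increment_pow_prod hB hτ T q
  have hi1 : Integrable (fun z : ℝ × Ω =>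
      Y z.1 z.2 * (B (τ z.2 + z.1.toNNReal) z.2 - B (τ z.2) z.2) ^ q) (μ.prod P) :=
    hW.bdd_mul (c := K) hYm.aestronglyMeasurable (ae_of_all _ fun z => hYK z.1 z.2)
  have hg : Integrable (fun u : ℝ => gaussMoment q u.toNNReal) μ :=
    (((continuous_gaussMoment _).comp continuous_real_toNNReal).integrableOn_Icc
      (a := 0) (b := (T : ℝ))).mono_set Set.Ioc_subset_Icc_self
  have hi2 : Integrable (fun z : ℝ × Ω => Y z.1 z.2 * gaussMoment q z.1.toNNReal)
      (μ.prod P) :=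
    (hg.comp_fst P).bdd_mul (c := K) hYm.aestronglyMeasurable (ae_of_all _ fun z => hYK z.1 z.2)
  simp only [cellIntegral, hrep]
  refine ⟨hi1.integral_prod_right, ?_⟩
  rw [← integral_integral_swap
      (f := fun u ω => Y u ω * (B (τ ω + u.toNNReal) ω - B (τ ω) ω) ^ q) hi1,
    ← integral_integral_swap (f := fun u ω => Y u ω * gaussMoment q u.toNNReal) hi2]
  refine integral_congr_ae (ae_of_all _ fun u => ?_)
  have hYu : Measurable[hτ.measurableSpace] (Y u) := by
    have key : ∀ {m : MeasurableSpace Ω}, Measurable[m] δ → Measurable[m] X →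
        Measurable[m] (Y u) := fun h1 h2 =>
      Measurable.ite (measurableSet_le measurable_const h1.coe_nnreal_real) h2 measurable_const
    exact key hδ hX
  have hind := (indepFun_increment hB hτ u.toNNReal hYu).comp measurable_id
    (measurable_id.pow_const q)
  simp only
  rw [integral_mul_const, ← (integral_increment_pow hB hτ q u.toNNReal).2]
  exact hind.integral_fun_mul_eq_mul_integral
    (hYu.mono hle le_rfl).aestronglyMeasurable
    (integral_increment_pow hB hτ q u.toNNReal).1.aestronglyMeasurable

theorem meanPower_eq (hB : IsFilteredBrownian B 𝓕 P) (p : ℕ) :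
    meanPower B P p = ∫ u in (0 : ℝ)..1, gaussMoment p u.toNNReal := by
  have hτ : IsFiniteStopping 𝓕 (fun _ : Ω => (0 : ℝ≥0)) := isStoppingTime_const 𝓕 0
  have h := (integral_mul_cellIntegral (T := 1) hB hτ (δ := fun _ => 1) measurable_const
    (fun _ => le_rfl) p (X := fun _ => 1) measurable_const (K := 1) (by simp)).2
  simp only [one_mul, cellIntegral, NNReal.coe_one, integral_const, probReal_univ, smul_eq_mul] at h
  rw [← h, meanPower]
  refine integral_congr_ae ?_
  filter_upwards [hB.preBrownian.eval_zero_ae_eq_zero] with ω h0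
  simp [h0]

theorem meanPower_one (hB : IsFilteredBrownian B 𝓕 P) : meanPower B P 1 = 0 := by
  simp [meanPower_eq hB, gaussMoment_one]

theorem integral_gaussMoment_two {d : ℝ} (hd : 0 ≤ d) :
    ∫ u in (0 : ℝ)..d, gaussMoment 2 u.toNNReal = d ^ 2 / 2 := by
  have : ∫ u in (0 : ℝ)..d, gaussMoment 2 u.toNNReal = ∫ u in (0 : ℝ)..d, u := by
    refine intervalIntegral.integral_congr fun u hu => ?_
    rw [Set.uIcc_of_le hd] at hu
    simp [gaussMoment_two, hu.1]
  rw [this, integral_id]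
  ring

theorem meanPower_two (hB : IsFilteredBrownian B 𝓕 P) : meanPower B P 2 = 1 / 2 := by
  rw [meanPower_eq hB, integral_gaussMoment_two zero_le_one]
  norm_num

/-- Brownian scaling gives the exponent `p/2 + 1`. It equals `p` when `p = 2`; when `p = 1` both
sides vanish, so `d ^ p` serves both cases. -/
theorem integral_gaussMoment (hB : IsFilteredBrownian B 𝓕 P) {p : ℕ} (hp : p = 1 ∨ p = 2)
    (d : ℝ≥0) : ∫ u in (0 : ℝ)..d, gaussMoment p u.toNNReal = meanPower B P p * d ^ p := by
  rcases hp with rfl | rfl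
  · simp [meanPower_one hB, gaussMoment_one]
  · rw [integral_gaussMoment_two d.coe_nonneg, meanPower_two hB]
    ring

theorem integral_gaussMoment_two_mul_le (p : ℕ) (d : ℝ≥0) :
    ∫ u in (0 : ℝ)..d, gaussMoment (2 * p) u.toNNReal ≤ gaussMoment (2 * p) 1 * d ^ (p + 1) := by
  have hc : Continuous fun u : ℝ => gaussMoment (2 * p) u.toNNReal :=
    (continuous_gaussMoment _).comp continuous_real_toNNReal
  calc ∫ u in (0 : ℝ)..d, gaussMoment (2 * p) u.toNNReal
      ≤ ∫ _ in (0 : ℝ)..d, (d : ℝ) ^ p * gaussMoment (2 * p) 1 := by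
        refine intervalIntegral.integral_mono_on d.coe_nonneg (hc.intervalIntegrable _ _) (by simp)
          fun u hu => ?_
        rw [gaussMoment_two_mul, Real.coe_toNNReal _ hu.1]
        gcongr
        · exact gaussMoment_two_mul_nonneg p 1
        · exact hu.1
        · exact hu.2
    _ = _ := by simp; ring

end CellIntegral

/-! ### Kolmogorov's maximal inequality for martingale differences -/

section Maximal

variable {P : Measure Ω} [IsProbabilityMeasure P] {𝓖 : Filtration ℕ mΩ} {ξ : ℕ → Ω → ℝ}

/-- The hypothesis `h0` says that `Z` has zero conditional expectation given `m`, and the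
`m`-measurable factor `Y` can be pulled out. -/
theorem setIntegral_mul_eq_zero_of_forall {m : MeasurableSpace Ω} (hm : m ≤ mΩ) {Y Z : Ω → ℝ}
    (hY : StronglyMeasurable[m] Y) (hYZ : Integrable (Y * Z) P) (hZ : Integrable Z P)
    (h0 : ∀ A, MeasurableSet[m] A → ∫ ω in A, Z ω ∂P = 0) {A : Set Ω} (hA : MeasurableSet[m] A) :
    ∫ ω in A, (Y * Z) ω ∂P = 0 := by
  have hc : (fun _ => (0 : ℝ)) =ᵐ[P] P[Z|m] :=
    ae_eq_condExp_of_forall_setIntegral_eq hm hZ (fun _ _ _ => integrableOn_zero)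
      (fun A hA _ => by simp [h0 A hA]) aestronglyMeasurable_const
  rw [← setIntegral_condExp hm hYZ hA,
    setIntegral_congr_ae (g := fun _ => (0 : ℝ)) (hm _ hA)]
  · simp
  · filter_upwards [condExp_mul_of_stronglyMeasurable_left hY hYZ hZ, hc] with ω h1 h2 _
    rw [h1, Pi.mul_apply, ← h2, mul_zero]

/-- Kolmogorov's maximal inequality for square integrable martingale differences. -/
theorem measure_exists_le_abs_sum_le (hm : ∀ k, StronglyMeasurable[𝓖 (k + 1)] (ξ k))
    (hL : ∀ k, MemLp (ξ k) 2 P)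
    (h0 : ∀ k A, MeasurableSet[𝓖 k] A → ∫ ω in A, ξ k ω ∂P = 0) {V : ℝ}
    (hV : ∀ K, ∑ k ∈ Finset.range K, ∫ ω, ξ k ω ^ 2 ∂P ≤ V) {ε : ℝ} (hε : 0 < ε) :
    P {ω | ∃ K, ε ≤ |∑ k ∈ Finset.range K, ξ k ω|} ≤ ENNReal.ofReal (V / ε ^ 2) := by
  set M : ℕ → Ω → ℝ := fun K => ∑ k ∈ Finset.range K, ξ k with hM
  have hMm : ∀ K, StronglyMeasurable[𝓖 K] (M K) := fun K =>
    Finset.stronglyMeasurable_sum _ fun k hk =>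
      (hm k).mono (𝓖.mono (Nat.succ_le_of_lt (Finset.mem_range.1 hk)))
  have hML : ∀ K, MemLp (M K) 2 P := fun K => memLp_finsetSum' _ fun k _ => hL k
  have hS : ∀ K, M (K + 1) = M K + ξ K := fun K => Finset.sum_range_succ _ _
  have hint : ∀ K, Integrable (fun ω => M K ω ^ 2) P := fun K => (hML K).integrable_sq
  have hprod : ∀ K, Integrable (M K * ξ K) P := fun K => (hML K).integrable_mul (hL K)
  -- The cross term vanishes by orthogonality. This yields both the submartingale property of `M²`
  -- and the formula for its expectation; Doob's inequality is then applied to `M²` at level `ε²`.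
  have hstep : ∀ K A, MeasurableSet[𝓖 K] A →
      ∫ ω in A, M (K + 1) ω ^ 2 ∂P = ∫ ω in A, M K ω ^ 2 ∂P + ∫ ω in A, ξ K ω ^ 2 ∂P := by
    intro K A hA
    have hc := setIntegral_mul_eq_zero_of_forall (𝓖.le K) (hMm K) (hprod K)
      ((hL K).integrable one_le_two) (h0 K) hA
    have he : ∀ ω, M (K + 1) ω ^ 2 = M K ω ^ 2 + 2 * (M K * ξ K) ω + ξ K ω ^ 2 := fun ω => by
      rw [hS]
      simp only [Pi.add_apply, Pi.mul_apply]
      ring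
    simp_rw [he]
    have hi : Integrable (fun ω => M K ω ^ 2 + 2 * (M K * ξ K) ω) P :=
      (hint K).add ((hprod K).const_mul 2)
    rw [integral_add hi.integrableOn (hL K).integrable_sq.integrableOn,
      integral_add (hint K).integrableOn ((hprod K).integrableOn.const_mul 2),
      integral_const_mul, hc]
    ring
  have hE : ∀ K, ∫ ω, M K ω ^ 2 ∂P = ∑ k ∈ Finset.range K, ∫ ω, ξ k ω ^ 2 ∂P := by
    intro K
    induction K with
    | zero => simp [hM]
    | succ K ih =>
      have := hstep K Set.univ MeasurableSet.univ
      simp only [setIntegral_univ] at this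
      rw [this, ih, Finset.sum_range_succ]
  have hsub : Submartingale (fun K ω => M K ω ^ 2) 𝓖 P :=
    submartingale_of_setIntegral_le_succ (fun K => (hMm K).pow 2) hint fun K A hA => by
      rw [hstep K A hA]
      have : 0 ≤ ∫ ω in A, ξ K ω ^ 2 ∂P := integral_nonneg fun ω => sq_nonneg _
      linarith
  have hbound : ∀ n : ℕ, P {ω | ∃ K ≤ n, ε ≤ |M K ω|} ≤ ENNReal.ofReal (V / ε ^ 2) := by
    intro n
    have h1 := maximal_ineq hsub (fun K ω => sq_nonneg _)
      (ε := (ε ^ 2).toNNReal) n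
    have hset : {ω | (((ε ^ 2).toNNReal : ℝ≥0) : ℝ) ≤
        (Finset.range (n + 1)).sup' Finset.nonempty_range_add_one fun k => M k ω ^ 2} =
        {ω | ∃ K ≤ n, ε ≤ |M K ω|} := by
      ext ω
      simp only [Set.mem_ofPred_eq, Finset.le_sup'_iff, Finset.mem_range, Nat.lt_succ_iff,
        Real.coe_toNNReal _ (sq_nonneg ε)]
      refine exists_congr fun K => and_congr_right fun _ => ?_
      rw [sq_le_sq, abs_of_pos hε]
    rw [hset] at h1
    have h2 : ENNReal.ofReal (∫ ω in {ω | ∃ K ≤ n, ε ≤ |M K ω|}, M n ω ^ 2 ∂P) ≤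
        ENNReal.ofReal V := by
      refine ENNReal.ofReal_le_ofReal (le_trans ?_ ((hE n).le.trans (hV n)))
      exact setIntegral_le_integral (hint n) (ae_of_all _ fun ω => sq_nonneg _)
    rw [ENNReal.ofReal_div_of_pos (by positivity), ENNReal.le_div_iff_mul_le
      (Or.inl (by simpa using hε.ne')) (Or.inl ENNReal.ofReal_ne_top), mul_comm]
    exact h1.trans h2
  have hU : {ω | ∃ K, ε ≤ |∑ k ∈ Finset.range K, ξ k ω|} = ⋃ n, {ω | ∃ K ≤ n, ε ≤ |M K ω|} := by
    ext ω
    simp only [hM, Set.mem_ofPred_eq, Finset.sum_apply, Set.mem_iUnion]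
    exact ⟨fun ⟨K, h⟩ => ⟨K, K, le_rfl, h⟩, fun ⟨_, K, _, h⟩ => ⟨K, h⟩⟩
  rw [hU, Monotone.measure_iUnion]
  · exact iSup_le hbound
  · rintro n n' hn ω ⟨K, hK, h⟩
    exact ⟨K, hK.trans hn, h⟩

end Maximal

/-! ### Step functions along a deterministic grid and the pathwise estimate -/

section Cells

/-- The function equal to `f k` on `[t k, t (k + 1))` for every `k`, and to `0` elsewhere. -/
def cellFun {α : Type*} [Preorder α] (t : ℕ → α) (f : ℕ → α → ℝ) (s : α) : ℝ :=
  ∑' k, (Set.Ico (t k) (t (k + 1))).indicator (f k) s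

theorem cellFun_of_mem {α : Type*} [LinearOrder α] {t : ℕ → α} (ht : Monotone t)
    (f : ℕ → α → ℝ) {k : ℕ} {s : α} (hs : s ∈ Set.Ico (t k) (t (k + 1))) :
    cellFun t f s = f k s := by
  rw [cellFun, tsum_eq_single k, Set.indicator_of_mem hs]
  intro j hj
  refine Set.indicator_of_notMem (fun hsj => hj ?_) _
  rcases lt_trichotomy j k with h | h | h
  · exact absurd (hsj.2.trans_le (ht h)) (not_lt.2 hs.1)
  · exact h
  · exact absurd (hs.2.trans_le (ht h)) (not_lt.2 hsj.1)

theorem cellFun_of_forall_le {α : Type*} [LinearOrder α] {t : ℕ → α} (f : ℕ → α → ℝ) {s : α}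
    (hs : ∀ k, t k ≤ s) : cellFun t f s = 0 := by
  rw [cellFun]
  refine (tsum_congr fun k => Set.indicator_of_notMem (fun h => ?_) _).trans tsum_zero
  exact absurd h.2 (not_lt.2 (hs _))

/-- The second alternative covers both times at or after the end of a grid that stops moving and
times beyond an accumulation point of the grid. -/
theorem exists_mem_cell_or_forall_le {α : Type*} [LinearOrder α] {t : ℕ → α} {s : α}
    (h0 : t 0 ≤ s) : (∃ k, s ∈ Set.Ico (t k) (t (k + 1))) ∨ ∀ k, t k ≤ s := by
  by_cases h : ∃ k, s ∈ Set.Ico (t k) (t (k + 1))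
  · exact Or.inl h
  · refine Or.inr fun k => ?_
    induction k with
    | zero => exact h0
    | succ k ih => exact not_lt.1 fun hlt => h ⟨k, ih, hlt⟩

theorem abs_sub_le_oscillation {f : ℝ → ℝ} {M u v : ℝ} {S : Set ℝ} (hM : ∀ s ∈ S, |f s| ≤ M)
    (hu : u ∈ S) (hv : v ∈ S) : |f u - f v| ≤ sSup (f '' S) - sInf (f '' S) := by
  have hA : BddAbove (f '' S) :=
    ⟨M, by rintro _ ⟨s, hs, rfl⟩; exact (abs_le.1 (hM s hs)).2⟩
  have hB : BddBelow (f '' S) :=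
    ⟨-M, by rintro _ ⟨s, hs, rfl⟩; exact (abs_le.1 (hM s hs)).1⟩
  have h1 := le_csSup hA (Set.mem_image_of_mem f hu)
  have h2 := le_csSup hA (Set.mem_image_of_mem f hv)
  have h3 := csInf_le hB (Set.mem_image_of_mem f hu)
  have h4 := csInf_le hB (Set.mem_image_of_mem f hv)
  rw [abs_le]
  constructor <;> linarith

/-- Subadditivity suffices and spares any measurability condition on `g`. -/
theorem lintegral_Ioc_le_sum (g : ℝ → ℝ≥0∞) {x : ℕ → ℝ} (hx : Monotone x) (m : ℕ) :
    ∫⁻ s in Set.Ioc (x 0) (x m), g s ≤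
      ∑ i ∈ Finset.range m, ∫⁻ s in Set.Ioc (x i) (x (i + 1)), g s := by
  induction m with
  | zero => simp
  | succ m ih =>
    rw [← Set.Ioc_union_Ioc_eq_Ioc (hx (Nat.zero_le m)) (hx (Nat.le_succ m)),
      Finset.sum_range_succ]
    exact (lintegral_union_le _ _ _).trans (add_le_add_left ih _)

/-- The left-point step functions of a Riemann integrable function along fine grids are close to
it in `L¹`. -/
theorem RiemannIntegrableOn.exists_forall_lintegral_sub_step_le {f : ℝ → ℝ} {T : ℝ} (hT : 0 ≤ T)
    (hf : RiemannIntegrableOn f 0 T) {ε : ℝ} (hε : 0 < ε) :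
    ∃ δ : ℝ, 0 < δ ∧ ∀ t : ℕ → ℝ, Monotone t → t 0 = 0 → (∀ k, t k ≤ T) →
      (∀ k, t (k + 1) - t k ≤ δ) → (∃ k, T - t k ≤ δ) →
      ∫⁻ s in Set.Ioc 0 T, ‖f s - cellFun t (fun k _ => f (t k)) s‖ₑ ≤ ENNReal.ofReal ε := by
  obtain ⟨⟨M, hM⟩, hD⟩ := hf
  have hM0 : 0 ≤ M := (abs_nonneg _).trans (hM 0 ⟨le_rfl, hT⟩)
  obtain ⟨m, x, hx, hx0, hxm, hosc⟩ := hD (ε / 2) (by positivity)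
  -- Each of the `m` partition cells costs at most `4 M δ` beyond its oscillation term; the `+ 1`
  -- keeps the denominator positive when `M` or `m` is zero.
  refine ⟨ε / 2 / (4 * M * m + 1), by positivity, ?_⟩
  set δ := ε / 2 / (4 * M * m + 1) with hδ
  have hδ0 : 0 < δ := by positivity
  intro t ht ht0 htT hmesh hend
  set g := cellFun t (fun k _ => f (t k)) with hg
  set o : ℕ → ℝ := fun i => sSup (f '' Set.Icc (x i) (x (i + 1))) -
    sInf (f '' Set.Icc (x i) (x (i + 1))) with ho
  have hcell : ∀ i < m, ∫⁻ s in Set.Ioc (x i) (x (i + 1)), ‖f s - g s‖ₑ ≤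
      ENNReal.ofReal (o i * (x (i + 1) - x i) + 4 * M * δ) := by
    intro i hi
    have hsub : Set.Icc (x i) (x (i + 1)) ⊆ Set.Icc 0 T := fun s hs =>
      ⟨hx0.symm.le.trans ((hx (Nat.zero_le i)).trans hs.1),
        hs.2.trans ((hx (Nat.succ_le_of_lt hi)).trans hxm.le)⟩
    have ho0 : 0 ≤ o i := (abs_nonneg _).trans (abs_sub_le_oscillation
      (fun s hs => hM s (hsub hs)) (Set.left_mem_Icc.2 (hx (Nat.le_succ i)))
      (Set.left_mem_Icc.2 (hx (Nat.le_succ i))))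
    have hpt : ∀ s ∈ Set.Ioc (x i) (x (i + 1)), ‖f s - g s‖ₑ ≤ ENNReal.ofReal (o i) +
        ((Set.Icc (x i) (x i + δ)).indicator (fun _ => ENNReal.ofReal (2 * M)) s +
        (Set.Icc (T - δ) T).indicator (fun _ => ENNReal.ofReal (2 * M)) s) := by
      intro s hs
      have hs' : s ∈ Set.Icc (x i) (x (i + 1)) := Set.Ioc_subset_Icc_self hs
      have hsT := hsub hs'
      rw [Real.enorm_eq_ofReal_abs]
      rcases exists_mem_cell_or_forall_le (t := t) (s := s) (ht0.le.trans hsT.1) with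
        ⟨k, hk⟩ | hall
      · have hgk : g s = f (t k) := cellFun_of_mem ht _ hk
        rw [hgk]
        -- If the left grid point lies in the same partition cell as `s`, the oscillation bounds the
        -- difference. Otherwise `s` is within one mesh of `x i`, where the crude bound `2 M` is
        -- used.
        by_cases hkx : x i ≤ t k
        · refine le_add_right (ENNReal.ofReal_le_ofReal ?_)
          exact abs_sub_le_oscillation (fun s hs => hM s (hsub hs)) hs' ⟨hkx, hk.1.trans hs'.2⟩
        · refine le_add_left (le_add_right ?_)
          have hmem : s ∈ Set.Icc (x i) (x i + δ) :=
            ⟨hs'.1, by linarith [hmesh k, hk.2, not_le.1 hkx]⟩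
          rw [Set.indicator_of_mem hmem]
          refine ENNReal.ofReal_le_ofReal ((abs_sub _ _).trans ?_)
          have := hM s hsT
          have := hM (t k) ⟨ht0.symm.le.trans (ht (Nat.zero_le k)), htT k⟩
          linarith
      · rw [hg, cellFun_of_forall_le _ hall, sub_zero]
        refine le_add_left (le_add_left ?_)
        obtain ⟨k, hk⟩ := hend
        have hmem : s ∈ Set.Icc (T - δ) T := ⟨by linarith [hall k], hsT.2⟩
        rw [Set.indicator_of_mem hmem]
        exact ENNReal.ofReal_le_ofReal (by linarith [hM s hsT])
    calc ∫⁻ s in Set.Ioc (x i) (x (i + 1)), ‖f s - g s‖ₑ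
        ≤ ∫⁻ s in Set.Ioc (x i) (x (i + 1)), (ENNReal.ofReal (o i) +
        ((Set.Icc (x i) (x i + δ)).indicator (fun _ => ENNReal.ofReal (2 * M)) s +
        (Set.Icc (T - δ) T).indicator (fun _ => ENNReal.ofReal (2 * M)) s)) :=
          setLIntegral_mono' measurableSet_Ioc hpt
      _ ≤ ENNReal.ofReal (o i) * ENNReal.ofReal (x (i + 1) - x i) +
          (ENNReal.ofReal (2 * M) * ENNReal.ofReal δ +
            ENNReal.ofReal (2 * M) * ENNReal.ofReal δ) := by
          rw [lintegral_add_left measurable_const,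
            lintegral_add_left (measurable_const.indicator measurableSet_Icc),
            setLIntegral_const, Real.volume_Ioc]
          gcongr
          · refine (setLIntegral_le_lintegral _ _).trans ?_
            rw [lintegral_indicator_const measurableSet_Icc, Real.volume_Icc]
            simp
          · refine (setLIntegral_le_lintegral _ _).trans ?_
            rw [lintegral_indicator_const measurableSet_Icc, Real.volume_Icc]
            simp
      _ = _ := by
          rw [← ENNReal.ofReal_mul ho0, ← ENNReal.ofReal_mul (by positivity),
            ← ENNReal.ofReal_add (by positivity) (by positivity), ← ENNReal.ofReal_add
              (mul_nonneg ho0 (sub_nonneg.2 (hx (Nat.le_succ i)))) (by positivity)]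
          congr 1
          ring
  have hsum := lintegral_Ioc_le_sum (fun s => ‖f s - g s‖ₑ) hx m
  rw [hx0, hxm] at hsum
  have hnn : ∀ i ∈ Finset.range m, 0 ≤ o i * (x (i + 1) - x i) + 4 * M * δ := by
    intro i hi
    have hi := Finset.mem_range.1 hi
    have hsub : Set.Icc (x i) (x (i + 1)) ⊆ Set.Icc 0 T := fun s hs =>
      ⟨hx0.symm.le.trans ((hx (Nat.zero_le i)).trans hs.1),
        hs.2.trans ((hx (Nat.succ_le_of_lt hi)).trans hxm.le)⟩
    have ho0 : 0 ≤ o i := (abs_nonneg _).trans (abs_sub_le_oscillation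
      (fun s hs => hM s (hsub hs)) (Set.left_mem_Icc.2 (hx (Nat.le_succ i)))
      (Set.left_mem_Icc.2 (hx (Nat.le_succ i))))
    exact add_nonneg (mul_nonneg ho0 (sub_nonneg.2 (hx (Nat.le_succ i)))) (by positivity)
  calc _ ≤ _ := hsum
    _ ≤ ∑ i ∈ Finset.range m, ENNReal.ofReal (o i * (x (i + 1) - x i) + 4 * M * δ) :=
        Finset.sum_le_sum fun i hi => hcell i (Finset.mem_range.1 hi)
    _ = ENNReal.ofReal (∑ i ∈ Finset.range m, (o i * (x (i + 1) - x i) + 4 * M * δ)) :=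
        (ENNReal.ofReal_sum_of_nonneg hnn).symm
    _ ≤ ENNReal.ofReal ε := by
        refine ENNReal.ofReal_le_ofReal ?_
        rw [Finset.sum_add_distrib, Finset.sum_const, Finset.card_range, nsmul_eq_mul]
        have h1 : ∑ i ∈ Finset.range m, o i * (x (i + 1) - x i) =
            upperSum f x m - lowerSum f x m := by
          rw [upperSum, lowerSum, ← Finset.sum_sub_distrib]
          exact Finset.sum_congr rfl fun i _ => by rw [ho, sub_mul]
        have h2 : (m : ℝ) * (4 * M * δ) ≤ ε / 2 := by
          have : δ * (4 * M * m + 1) = ε / 2 := by rw [hδ]; field_simp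
          nlinarith
        rw [h1]
        linarith

/-- Pathwise estimate: the distance between the primitives of `ψ` and of `e f`, in terms of the
increments of the primitive of `ψ` along the grid `t`. -/
theorem abs_primitive_sub_le {t : ℕ → ℝ} {T e : ℝ} {ψ f : ℝ → ℝ} {m : ℕ → ℝ}
    {ε₁ ε₂ ε₃ ε₄ ε₅ : ℝ} (ht : Monotone t) (ht0 : t 0 = 0) (htT : ∀ k, t k ≤ T)
    (he0 : 0 ≤ e) (he1 : e ≤ 1)
    (hψ : IntervalIntegrable ψ volume 0 T) (hf : IntervalIntegrable f volume 0 T)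
    (hg : IntervalIntegrable (cellFun t fun k _ => f (t k)) volume 0 T)
    (hψ0 : ∀ s, (∀ k, t k ≤ s) → s ≤ T → ψ s = 0)
    (h1 : ∀ K, |∑ k ∈ Finset.range K, ((∫ u in (t k)..(t (k + 1)), ψ u) - m k)| ≤ ε₁)
    (h2 : ∀ k, ∀ s ∈ Set.Icc (t k) (t (k + 1)), |∫ u in (t k)..s, ψ u| ≤ ε₂)
    (h3 : ∀ K, |∑ k ∈ Finset.range K, (m k - e * (f (t k) * (t (k + 1) - t k)))| ≤ ε₃)
    (h4 : ∫⁻ s in Set.Ioc 0 T, ‖f s - cellFun t (fun k _ => f (t k)) s‖ₑ ≤ ENNReal.ofReal ε₄)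
    (hε₄ : 0 ≤ ε₄) (h5 : ∀ k, |f (t k)| * (t (k + 1) - t k) ≤ ε₅) {s : ℝ} (hs0 : 0 ≤ s)
    (hsT : s ≤ T) :
    |(∫ u in (0 : ℝ)..s, ψ u) - e * ∫ u in (0 : ℝ)..s, f u| ≤ ε₁ + ε₂ + ε₃ + 2 * ε₄ + ε₅ := by
  have hT : 0 ≤ T := hs0.trans hsT
  set g := cellFun t fun k _ => f (t k) with hgdef
  have ht0' : ∀ k, 0 ≤ t k := fun k => ht0.symm.le.trans (ht (Nat.zero_le k))
  have hsubI : ∀ {h : ℝ → ℝ}, IntervalIntegrable h volume 0 T → ∀ {u v : ℝ}, 0 ≤ u → u ≤ T →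
      0 ≤ v → v ≤ T → IntervalIntegrable h volume u v := fun hh u v hu hu' hv hv' =>
    hh.mono_set (by
      rw [Set.uIcc_of_le hT]
      exact Set.uIcc_subset_Icc ⟨hu, hu'⟩ ⟨hv, hv'⟩)
  have hfg : ∀ u v : ℝ, 0 ≤ u → u ≤ v → v ≤ T → |∫ s in u..v, (f s - g s)| ≤ ε₄ := by
    intro u v hu huv hv
    rw [intervalIntegral.integral_of_le huv, ← Real.norm_eq_abs]
    refine (norm_integral_le_lintegral_norm _).trans ?_
    refine ENNReal.toReal_le_of_le_ofReal hε₄ (le_trans ?_ h4)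
    simp_rw [ofReal_norm]
    exact lintegral_mono_set (Set.Ioc_subset_Ioc hu hv)
  have hgcell : ∀ k, ∀ s ∈ Set.Icc (t k) (t (k + 1)),
      ∫ u in (t k)..s, g u = f (t k) * (s - t k) := by
    intro k s hs
    rw [intervalIntegral.integral_of_le hs.1, integral_Ioc_eq_integral_Ioo,
      setIntegral_congr_fun (g := fun _ => f (t k)) measurableSet_Ioo]
    · simp [hs.1, mul_comm]
    · intro u hu
      exact cellFun_of_mem ht _ ⟨hu.1.le, hu.2.trans_le hs.2⟩
  have hsumI : ∀ {h : ℝ → ℝ}, IntervalIntegrable h volume 0 T → ∀ K,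
      ∫ u in (0 : ℝ)..(t K), h u = ∑ k ∈ Finset.range K, ∫ u in (t k)..(t (k + 1)), h u := by
    intro h hh K
    rw [intervalIntegral.sum_integral_adjacent_intervals
      (fun k _ => hsubI hh (ht0' _) (htT _) (ht0' _) (htT _)), ht0]
  have hfgI : ∀ u v : ℝ, 0 ≤ u → u ≤ v → v ≤ T → ∫ s in u..v, f s =
      (∫ s in u..v, g s) + ∫ s in u..v, (f s - g s) := by
    intro u v hu huv hv
    rw [intervalIntegral.integral_sub (hsubI hf hu (huv.trans hv) (hu.trans huv) hv)
      (hsubI hg hu (huv.trans hv) (hu.trans huv) hv)]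
    ring
  have hmain : ∀ k, ∀ s ∈ Set.Icc (t k) (t (k + 1)),
      |(∫ u in (0 : ℝ)..s, ψ u) - e * ∫ u in (0 : ℝ)..s, f u| ≤
        ε₁ + ε₂ + ε₃ + ε₄ + ε₅ := by
    intro K s hs
    have hs0 : 0 ≤ s := (ht0' K).trans hs.1
    have hsT : s ≤ T := hs.2.trans (htT _)
    have eψ : ∫ u in (0 : ℝ)..s, ψ u =
        (∑ k ∈ Finset.range K, ∫ u in (t k)..(t (k + 1)), ψ u) + ∫ u in (t K)..s, ψ u := by
      rw [← hsumI hψ, intervalIntegral.integral_add_adjacent_intervals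
        (hsubI hψ le_rfl hT (ht0' _) (htT _)) (hsubI hψ (ht0' _) (htT _) hs0 hsT)]
    have eg : ∫ u in (0 : ℝ)..s, g u =
        (∑ k ∈ Finset.range K, f (t k) * (t (k + 1) - t k)) + f (t K) * (s - t K) := by
      rw [← hgcell K s hs, ← Finset.sum_congr rfl fun k _ => hgcell k (t (k + 1))
        ⟨ht (Nat.le_succ k), le_rfl⟩, ← hsumI hg,
        intervalIntegral.integral_add_adjacent_intervals
        (hsubI hg le_rfl hT (ht0' _) (htT _)) (hsubI hg (ht0' _) (htT _) hs0 hsT)]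
    have a1 := h1 K
    have a2 := h2 K s hs
    have a3 := h3 K
    have a4 := hfg 0 s le_rfl hs0 hsT
    have a5 : |f (t K) * (s - t K)| ≤ ε₅ := by
      rw [abs_mul, abs_of_nonneg (sub_nonneg.2 hs.1)]
      exact (mul_le_mul_of_nonneg_left (by linarith [hs.2]) (abs_nonneg _)).trans (h5 K)
    -- The terms are, in order: fluctuation, compensator against Riemann term, the incomplete cell
    -- of `ψ`, the incomplete cell of the step function, and the `L¹` step error.
    have hd : (∫ u in (0 : ℝ)..s, ψ u) - e * ∫ u in (0 : ℝ)..s, f u =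
        (∑ k ∈ Finset.range K, ((∫ u in (t k)..(t (k + 1)), ψ u) - m k)) +
        (∑ k ∈ Finset.range K, (m k - e * (f (t k) * (t (k + 1) - t k)))) +
        (∫ u in (t K)..s, ψ u) - e * (f (t K) * (s - t K)) -
        e * ∫ u in (0 : ℝ)..s, (f u - g u) := by
      rw [hfgI 0 s le_rfl hs0 hsT, eψ, eg, Finset.sum_sub_distrib, Finset.sum_sub_distrib,
        ← Finset.mul_sum]
      ring
    have b4 : |e * ∫ u in (0 : ℝ)..s, (f u - g u)| ≤ ε₄ := by
      rw [abs_mul, abs_of_nonneg he0]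
      exact (mul_le_of_le_one_left (abs_nonneg _) he1).trans a4
    have b5 : |e * (f (t K) * (s - t K))| ≤ ε₅ := by
      rw [abs_mul, abs_of_nonneg he0]
      exact (mul_le_of_le_one_left (abs_nonneg _) he1).trans a5
    rw [hd]
    rw [abs_le] at *
    constructor <;> linarith
  rcases exists_mem_cell_or_forall_le (t := t) (s := s) (ht0.le.trans hs0) with ⟨k, hk⟩ | hall
  · have := hmain k s ⟨hk.1, hk.2.le⟩
    linarith
  -- Here `s` lies beyond every grid point. The bound passes to the limit `L` of the grid by
  -- continuity of primitives; on `[L, s]` both `ψ` and `g` vanish, so `f = f - g` there, which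
  -- costs the second `ε₄`.
  · set L := ⨆ k, t k with hL
    have hbdd : BddAbove (Set.range t) := ⟨s, by rintro _ ⟨k, rfl⟩; exact hall k⟩
    have htend : Tendsto t atTop (𝓝 L) := tendsto_atTop_ciSup ht hbdd
    have hLs : L ≤ s := ciSup_le hall
    have hkL : ∀ k, t k ≤ L := le_ciSup hbdd
    have hL0 : 0 ≤ L := (ht0' 0).trans (hkL 0)
    have hLT : L ≤ T := hLs.trans hsT
    have hprim : ∀ {h : ℝ → ℝ}, IntervalIntegrable h volume 0 T →
        Tendsto (fun k => ∫ u in (0 : ℝ)..(t k), h u) atTop (𝓝 (∫ u in (0 : ℝ)..L, h u)) := by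
      intro h hh
      have hc := intervalIntegral.continuousOn_primitive_interval
        ((intervalIntegrable_iff_integrableOn_Icc_of_le hT).1 hh |>.mono_set
          (Set.uIcc_of_le hT).subset)
      rw [Set.uIcc_of_le hT] at hc
      exact (hc L ⟨hL0, hLT⟩).tendsto.comp
        (tendsto_nhdsWithin_iff.2 ⟨htend, Eventually.of_forall fun k => ⟨ht0' k, htT k⟩⟩)
    have hlim := ((hprim hψ).sub ((hprim hf).const_mul e)).abs
    have hle : |(∫ u in (0 : ℝ)..L, ψ u) - e * ∫ u in (0 : ℝ)..L, f u| ≤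
        ε₁ + ε₂ + ε₃ + ε₄ + ε₅ :=
      le_of_tendsto' hlim fun k => hmain k (t k) ⟨le_rfl, ht (Nat.le_succ k)⟩
    have hψL : ∫ u in L..s, ψ u = 0 := by
      rw [intervalIntegral.integral_congr (g := fun _ => (0 : ℝ))]
      · simp
      · intro u hu
        rw [Set.uIcc_of_le hLs] at hu
        exact hψ0 u (fun k => (hkL k).trans hu.1) (hu.2.trans hsT)
    have hgL : ∫ u in L..s, g u = 0 := by
      rw [intervalIntegral.integral_congr (g := fun _ => (0 : ℝ))]
      · simp
      · intro u hu
        rw [Set.uIcc_of_le hLs] at hu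
        exact cellFun_of_forall_le _ fun k => (hkL k).trans hu.1
    have hfL : |e * ∫ u in L..s, f u| ≤ ε₄ := by
      rw [abs_mul, abs_of_nonneg he0, hfgI L s hL0 hLs hsT, hgL, zero_add]
      exact (mul_le_of_le_one_left (abs_nonneg _) he1).trans (hfg L s hL0 hLs hsT)
    rw [← intervalIntegral.integral_add_adjacent_intervals (hsubI hψ le_rfl hT hL0 hLT)
      (hsubI hψ hL0 hLT hs0 hsT), ← intervalIntegral.integral_add_adjacent_intervals
      (hsubI hf le_rfl hT hL0 hLT) (hsubI hf hL0 hLT hs0 hsT), hψL]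
    rw [abs_le] at *
    constructor <;> linarith

end Cells

/-! ### The random grid: stopping times, truncated weights and variance bounds -/

section Grid

variable {P : Measure Ω} {𝓕 : Filtration ℝ≥0 mΩ} {a θ B : ℝ≥0 → Ω → ℝ} {T : ℝ≥0} {p n : ℕ}

/-- The length of the `k`-th cell of the random grid. -/
def cellLength (θ : ℝ≥0 → Ω → ℝ) (T : ℝ≥0) (n k : ℕ) (ω : Ω) : ℝ≥0 :=
  min (Real.toNNReal (1 / (n * θ (gridPoint θ T n k ω) ω))) (T - gridPoint θ T n k ω)

theorem gridPoint_le (θ : ℝ≥0 → Ω → ℝ) (T : ℝ≥0) (n k : ℕ) (ω : Ω) :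
    gridPoint θ T n k ω ≤ T := by
  cases k with
  | zero => exact zero_le
  | succ k => exact min_le_right _ _

/-- In this additive form the next grid point is a stopping time by `IsFiniteStopping.add`. -/
theorem gridPoint_succ (θ : ℝ≥0 → Ω → ℝ) (T : ℝ≥0) (n k : ℕ) (ω : Ω) :
    gridPoint θ T n (k + 1) ω = gridPoint θ T n k ω + cellLength θ T n k ω := by
  have h : T = gridPoint θ T n k ω + (T - gridPoint θ T n k ω) :=
    (add_tsub_cancel_of_le (gridPoint_le θ T n k ω)).symm
  rw [cellLength, ← min_add_add_left, ← h]
  rfl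

theorem monotone_gridPoint (θ : ℝ≥0 → Ω → ℝ) (T : ℝ≥0) (n : ℕ) (ω : Ω) :
    Monotone fun k => gridPoint θ T n k ω :=
  monotone_nat_of_le_succ fun k => by
    simp only [gridPoint_succ]
    exact le_self_add

theorem cellLength_le (θ : ℝ≥0 → Ω → ℝ) (T : ℝ≥0) (n k : ℕ) (ω : Ω) :
    cellLength θ T n k ω ≤ T := (min_le_right _ _).trans tsub_le_self

theorem cellLength_eq_sub (θ : ℝ≥0 → Ω → ℝ) (T : ℝ≥0) (n k : ℕ) (ω : Ω) :
    (gridPoint θ T n (k + 1) ω : ℝ) - gridPoint θ T n k ω = cellLength θ T n k ω := by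
  rw [gridPoint_succ]
  push_cast
  ring

theorem measurable_cellLength_of_isFiniteStopping (hθ : IsStronglyProgressive 𝓕 θ) {k : ℕ}
    (h : IsFiniteStopping 𝓕 (gridPoint θ T n k)) :
    Measurable[h.measurableSpace] (cellLength θ T n k) := by
  have key : ∀ {m : MeasurableSpace Ω}, Measurable[m] (gridPoint θ T n k) →
      Measurable[m] (fun ω => θ (gridPoint θ T n k ω) ω) →
      Measurable[m] (cellLength θ T n k) := fun h1 h2 =>
    (Measurable.real_toNNReal (measurable_const.div (measurable_const.mul h2))).min
      (measurable_const.sub h1)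
  exact key h.measurable_self (h.measurable_value hθ)

theorem isFiniteStopping_gridPoint (hθ : IsStronglyProgressive 𝓕 θ) (T : ℝ≥0) (n k : ℕ) :
    IsFiniteStopping 𝓕 (gridPoint θ T n k) := by
  induction k with
  | zero => exact isStoppingTime_const 𝓕 0
  | succ k ih =>
    have := ih.add (measurable_cellLength_of_isFiniteStopping hθ ih)
    have he : gridPoint θ T n (k + 1) = fun ω => gridPoint θ T n k ω + cellLength θ T n k ω :=
      funext fun ω => gridPoint_succ θ T n k ω
    rwa [he]

/-- The filtration of the pasts of the grid points. -/
def gridFiltration (hθ : IsStronglyProgressive 𝓕 θ) (T : ℝ≥0) (n : ℕ) : Filtration ℕ mΩ where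
  seq k := (isFiniteStopping_gridPoint hθ T n k).measurableSpace
  mono' i j hij := IsStoppingTime.measurableSpace_mono _ _ fun ω => by
    exact WithTop.coe_le_coe.2 (monotone_gridPoint θ T n ω hij)
  le' k := (isFiniteStopping_gridPoint hθ T n k).measurableSpace_le

theorem measurable_gridPoint (hθ : IsStronglyProgressive 𝓕 θ) (T : ℝ≥0) (n k : ℕ) :
    Measurable[gridFiltration hθ T n k] (gridPoint θ T n k) :=
  (isFiniteStopping_gridPoint hθ T n k).measurable_self

theorem measurable_cellLength (hθ : IsStronglyProgressive 𝓕 θ) (T : ℝ≥0) (n k : ℕ) :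
    Measurable[gridFiltration hθ T n k] (cellLength θ T n k) :=
  measurable_cellLength_of_isFiniteStopping hθ (isFiniteStopping_gridPoint hθ T n k)

theorem measurable_gridPoint_value (hθ : IsStronglyProgressive 𝓕 θ) (T : ℝ≥0) (n k : ℕ)
    {u : ℝ≥0 → Ω → ℝ} (hu : IsStronglyProgressive 𝓕 u) :
    Measurable[gridFiltration hθ T n k] (fun ω => u (gridPoint θ T n k ω) ω) :=
  (isFiniteStopping_gridPoint hθ T n k).measurable_value hu

theorem measurable_gridPoint_ratio (ha : IsStronglyProgressive 𝓕 a)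
    (hθ : IsStronglyProgressive 𝓕 θ) (T : ℝ≥0) (p n k : ℕ) :
    Measurable[gridFiltration hθ T n k] (fun ω => ratio a θ p (gridPoint θ T n k ω) ω) := by
  have key : ∀ {m : MeasurableSpace Ω} {x y : Ω → ℝ}, Measurable[m] x → Measurable[m] y →
      Measurable[m] fun ω => x ω / y ω ^ ((p : ℝ) / 2) :=
    fun h1 h2 => h1.div (h2.pow_const _)
  exact key (measurable_gridPoint_value hθ T n k ha) (measurable_gridPoint_value hθ T n k hθ)

/-- Up to the `k`-th grid point, `a` and `a / θ^(p/2)` are bounded by `C` along the grid and the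
cells are no longer than `d`. -/
def controlSet (a θ : ℝ≥0 → Ω → ℝ) (T : ℝ≥0) (p n : ℕ) (C d : ℝ) (k : ℕ) : Set Ω :=
  {ω | ∀ j ≤ k, |a (gridPoint θ T n j ω) ω| ≤ C ∧ |ratio a θ p (gridPoint θ T n j ω) ω| ≤ C ∧
    (cellLength θ T n j ω : ℝ) ≤ d}

theorem measurableSet_controlSet (ha : IsStronglyProgressive 𝓕 a)
    (hθ : IsStronglyProgressive 𝓕 θ) (T : ℝ≥0) (p n : ℕ) (C d : ℝ) (k : ℕ) :
    MeasurableSet[gridFiltration hθ T n k] (controlSet a θ T p n C d k) := by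
  have key : ∀ {m : MeasurableSpace Ω} {x y : Ω → ℝ} {z : Ω → ℝ≥0}, Measurable[m] x →
      Measurable[m] y → Measurable[m] z →
      MeasurableSet[m] {ω | |x ω| ≤ C ∧ |y ω| ≤ C ∧ (z ω : ℝ) ≤ d} :=
    fun h1 h2 h3 => (measurableSet_le (measurable_norm.comp h1) measurable_const).inter
      ((measurableSet_le (measurable_norm.comp h2) measurable_const).inter
        (measurableSet_le h3.coe_nnreal_real measurable_const))
  have he : controlSet a θ T p n C d k = ⋂ j ∈ Finset.range (k + 1),
      {ω | |a (gridPoint θ T n j ω) ω| ≤ C ∧ |ratio a θ p (gridPoint θ T n j ω) ω| ≤ C ∧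
        (cellLength θ T n j ω : ℝ) ≤ d} := by
    ext ω
    simp [controlSet]
  rw [he]
  refine Finset.measurableSet_biInter _ fun j hj => ?_
  exact (gridFiltration hθ T n).mono (Nat.lt_succ_iff.1 (Finset.mem_range.1 hj)) _
    (key (measurable_gridPoint_value hθ T n j ha) (measurable_gridPoint_ratio ha hθ T p n j)
      (measurable_cellLength hθ T n j))

/-- The weight `n^(p/2) a(τ_k)`, set to `0` outside `controlSet`. -/
def weight (a θ : ℝ≥0 → Ω → ℝ) (T : ℝ≥0) (p n : ℕ) (C d : ℝ) (k : ℕ) (ω : Ω) : ℝ :=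
  (controlSet a θ T p n C d k).indicator
    (fun ω => (n : ℝ) ^ ((p : ℝ) / 2) * a (gridPoint θ T n k ω) ω) ω

theorem measurable_weight (ha : IsStronglyProgressive 𝓕 a)
    (hθ : IsStronglyProgressive 𝓕 θ) (T : ℝ≥0) (p n : ℕ) (C d : ℝ) (k : ℕ) :
    Measurable[gridFiltration hθ T n k] (weight a θ T p n C d k) :=
  Measurable.indicator (m := gridFiltration hθ T n k)
    (Measurable.const_mul (measurable_gridPoint_value hθ T n k ha) _)
    (measurableSet_controlSet ha hθ T p n C d k)

/-- This bound grows with `n` and only secures integrability; the estimates uniform in `n` rest on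
`sq_weight_mul_pow_le`. -/
theorem abs_weight_le {C : ℝ} (hC : 0 ≤ C) (d : ℝ) (k : ℕ) (ω : Ω) :
    |weight a θ T p n C d k ω| ≤ (n : ℝ) ^ ((p : ℝ) / 2) * C := by
  have hn : (0 : ℝ) ≤ (n : ℝ) ^ ((p : ℝ) / 2) := by positivity
  by_cases h : ω ∈ controlSet a θ T p n C d k
  · rw [weight, Set.indicator_of_mem h, abs_mul, abs_of_nonneg hn]
    exact mul_le_mul_of_nonneg_left (h k le_rfl).1 hn
  · rw [weight, Set.indicator_of_notMem h, abs_zero]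
    positivity

theorem mul_cellLength_le_one (hθ_pos : ∀ ω, ∀ t ≤ T, 0 < θ t ω) (k : ℕ) (ω : Ω) :
    n * θ (gridPoint θ T n k ω) ω * cellLength θ T n k ω ≤ 1 := by
  have hθ := hθ_pos ω _ (gridPoint_le θ T n k ω)
  rcases Nat.eq_zero_or_pos n with rfl | hn
  · simp
  have hpos : 0 < n * θ (gridPoint θ T n k ω) ω := by positivity
  have h : (cellLength θ T n k ω : ℝ) ≤ 1 / (n * θ (gridPoint θ T n k ω) ω) := by
    refine (NNReal.coe_le_coe.2 (min_le_left _ _)).trans ?_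
    rw [Real.coe_toNNReal _ (by positivity)]
  rw [le_div_iff₀ hpos] at h
  linarith

/-- The powers of `n` cancel here: `n^p a² δ^p = (a/θ^(p/2))² (n θ δ)^p ≤ C²`. Of the remaining
`δ²`, one factor is bounded by `d` and the other is kept so that the bounds can be summed over
cells. -/
theorem sq_weight_mul_pow_le (hθ_pos : ∀ ω, ∀ t ≤ T, 0 < θ t ω) {C d : ℝ} (hd : 0 ≤ d)
    (k : ℕ) (ω : Ω) : weight a θ T p n C d k ω ^ 2 * (cellLength θ T n k ω : ℝ) ^ (p + 2) ≤
      C ^ 2 * d * cellLength θ T n k ω := by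
  set δ : ℝ := NNReal.toReal (cellLength θ T n k ω)
  have hδ0 : 0 ≤ δ := NNReal.coe_nonneg _
  by_cases h : ω ∈ controlSet a θ T p n C d k
  · obtain ⟨h1, h2, h3⟩ := h k le_rfl
    rw [weight, Set.indicator_of_mem h]
    set x := gridPoint θ T n k ω
    have hθ := hθ_pos ω x (gridPoint_le θ T n k ω)
    have hle : n * θ x ω * δ ≤ 1 := mul_cellLength_le_one hθ_pos k ω
    have hsq : ∀ y : ℝ, 0 ≤ y → (y ^ ((p : ℝ) / 2)) ^ 2 = y ^ p := fun y hy => by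
      rw [← Real.rpow_natCast, ← Real.rpow_mul hy]
      norm_num
    have hr : ((n : ℝ) ^ ((p : ℝ) / 2) * a x ω) ^ 2 * δ ^ p =
        ratio a θ p x ω ^ 2 * (n * θ x ω * δ) ^ p := by
      rw [ratio, div_pow, hsq _ hθ.le, mul_pow, hsq _ (Nat.cast_nonneg n), mul_pow, mul_pow]
      field_simp
    have hC : ratio a θ p x ω ^ 2 ≤ C ^ 2 := sq_le_sq' (abs_le.1 h2).1 (abs_le.1 h2).2
    have hpow : (n * θ x ω * δ) ^ p ≤ 1 := pow_le_one₀ (by positivity) hle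
    have h4 : ((n : ℝ) ^ ((p : ℝ) / 2) * a x ω) ^ 2 * δ ^ p ≤ C ^ 2 := by
      rw [hr]
      exact (mul_le_of_le_one_right (sq_nonneg _) hpow).trans hC
    calc _ = (((n : ℝ) ^ ((p : ℝ) / 2) * a x ω) ^ 2 * δ ^ p) * (δ * δ) := by ring
      _ ≤ C ^ 2 * (d * δ) := by gcongr
      _ = _ := by ring
  · rw [weight, Set.indicator_of_notMem h]
    have : 0 ≤ C ^ 2 * d * δ := by positivity
    simpa using this

/-- The weighted and compensated integral of `(B - B(τ_k))^p` over the `k`-th cell. -/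
def compensatedCell (a θ B : ℝ≥0 → Ω → ℝ) (P : Measure Ω) (T : ℝ≥0) (p n : ℕ) (C d : ℝ) (k : ℕ)
    (ω : Ω) : ℝ :=
  weight a θ T p n C d k ω * (cellIntegral B p (gridPoint θ T n k) (cellLength θ T n k) ω -
    meanPower B P p * (cellLength θ T n k ω : ℝ) ^ p)

/-- A bound for the square of the weighted integral of `(B - B(τ_k))^p` over the `k`-th cell. -/
def cellEnergy (a θ B : ℝ≥0 → Ω → ℝ) (T : ℝ≥0) (p n : ℕ) (C d : ℝ) (k : ℕ) (ω : Ω) : ℝ :=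
  weight a θ T p n C d k ω ^ 2 * cellLength θ T n k ω *
    cellIntegral B (2 * p) (gridPoint θ T n k) (cellLength θ T n k) ω

theorem measurable_compensatedCell (hB : IsFilteredBrownian B 𝓕 P)
    (ha : IsStronglyProgressive 𝓕 a) (hθ : IsStronglyProgressive 𝓕 θ) (C d : ℝ) (k : ℕ) :
    StronglyMeasurable[gridFiltration hθ T n (k + 1)]
      (compensatedCell a θ B P T p n C d k) := by
  have key : ∀ {m : MeasurableSpace Ω} {x y : Ω → ℝ} {z : Ω → ℝ≥0}, Measurable[m] x →
      Measurable[m] y → Measurable[m] z →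
      StronglyMeasurable[m] fun ω => x ω * (y ω - meanPower B P p * (z ω : ℝ) ^ p) :=
    fun h1 h2 h3 => (h1.mul (h2.sub ((h3.coe_nnreal_real.pow_const p).const_mul _))
      ).stronglyMeasurable
  have hmono := (gridFiltration hθ T n).mono (Nat.le_succ k)
  exact key ((measurable_weight ha hθ T p n C d k).mono hmono le_rfl)
    (measurable_cellIntegral hB (isFiniteStopping_gridPoint hθ T n k)
      (measurable_cellLength hθ T n k) (cellLength_le θ T n k)
      (isFiniteStopping_gridPoint hθ T n (k + 1)) (gridPoint_succ θ T n k) p)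
    ((measurable_cellLength hθ T n k).mono hmono le_rfl)

theorem sq_integral_increment_le (hB : IsFilteredBrownian B 𝓕 P) (p : ℕ) (τ δ : Ω → ℝ≥0) (ω : Ω)
    {t : ℝ} (ht : 0 ≤ t) (htδ : t ≤ δ ω) :
    (∫ u in (0 : ℝ)..t, (B (τ ω + u.toNNReal) ω - B (τ ω) ω) ^ p) ^ 2 ≤
      δ ω * cellIntegral B (2 * p) τ δ ω := by
  refine (sq_intervalIntegral_le ((continuous_increment hB (τ ω) ω).pow p) ht htδ).trans_eq ?_
  simp only [cellIntegral, mul_comm 2 p, pow_mul, Pi.pow_apply]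

variable [IsProbabilityMeasure P]

theorem integrable_cellLength (hθ : IsStronglyProgressive 𝓕 θ) (T : ℝ≥0) (n k : ℕ) :
    Integrable (fun ω => (cellLength θ T n k ω : ℝ)) P := by
  refine Integrable.of_bound ((measurable_cellLength hθ T n k).mono
    ((gridFiltration hθ T n).le k) le_rfl).coe_nnreal_real.aestronglyMeasurable T
    (ae_of_all _ fun ω => ?_)
  rw [Real.norm_of_nonneg (NNReal.coe_nonneg _)]
  exact_mod_cast cellLength_le θ T n k ω

/-- The `2p`-th moment integrated over a cell is at most a constant times `δ^(p+1)`; with the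
prefactor `weight² δ` this is the quantity bounded in `sq_weight_mul_pow_le`. -/
theorem integral_cellEnergy_le (hB : IsFilteredBrownian B 𝓕 P) (ha : IsStronglyProgressive 𝓕 a)
    (hθ : IsStronglyProgressive 𝓕 θ) (hθ_pos : ∀ ω, ∀ t ≤ T, 0 < θ t ω) {C d : ℝ} (hC : 0 ≤ C)
    (hd : 0 ≤ d) (k : ℕ) :
    Integrable (cellEnergy a θ B T p n C d k) P ∧
    ∫ ω, cellEnergy a θ B T p n C d k ω ∂P ≤
      gaussMoment (2 * p) 1 * (C ^ 2 * d) * ∫ ω, (cellLength θ T n k ω : ℝ) ∂P := by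
  have key : ∀ {m : MeasurableSpace Ω} {x : Ω → ℝ} {y : Ω → ℝ≥0}, Measurable[m] x →
      Measurable[m] y → Measurable[m] fun ω => x ω ^ 2 * (y ω : ℝ) :=
    fun h1 h2 => (h1.pow_const 2).mul h2.coe_nnreal_real
  have hX := key (measurable_weight ha hθ T p n C d k) (measurable_cellLength hθ T n k)
  have hXK : ∀ ω, |weight a θ T p n C d k ω ^ 2 * (cellLength θ T n k ω : ℝ)| ≤
      ((n : ℝ) ^ ((p : ℝ) / 2) * C) ^ 2 * T := fun ω => by
    rw [abs_mul, abs_pow, abs_of_nonneg (NNReal.coe_nonneg _)]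
    gcongr
    · exact abs_weight_le hC d k ω
    · exact cellLength_le θ T n k ω
  have h := integral_mul_cellIntegral hB (isFiniteStopping_gridPoint hθ T n k)
    (measurable_cellLength hθ T n k) (cellLength_le θ T n k) (2 * p) hX hXK
  refine ⟨h.1, h.2.trans_le ?_⟩
  rw [← integral_const_mul]
  refine integral_mono_of_nonneg (ae_of_all _ fun ω => ?_)
    ((integrable_cellLength hθ T n k).const_mul _) (ae_of_all _ fun ω => ?_)
  · refine mul_nonneg (by positivity) (intervalIntegral.integral_nonneg (NNReal.coe_nonneg _)
      fun u _ => gaussMoment_two_mul_nonneg p _)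
  · have h1 := integral_gaussMoment_two_mul_le p (cellLength θ T n k ω)
    have h2 := sq_weight_mul_pow_le (p := p) (n := n) (a := a) hθ_pos (C := C) hd k ω
    have h3 := gaussMoment_two_mul_nonneg p 1
    calc _ ≤ weight a θ T p n C d k ω ^ 2 * (cellLength θ T n k ω : ℝ) *
          (gaussMoment (2 * p) 1 * (cellLength θ T n k ω : ℝ) ^ (p + 1)) :=
          mul_le_mul_of_nonneg_left h1 (by positivity)
      _ = gaussMoment (2 * p) 1 *
          (weight a θ T p n C d k ω ^ 2 * (cellLength θ T n k ω : ℝ) ^ (p + 2)) := by ring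
      _ ≤ gaussMoment (2 * p) 1 * (C ^ 2 * d * cellLength θ T n k ω) := by gcongr
      _ = _ := by ring

theorem sq_meanPower_mul_le (hB : IsFilteredBrownian B 𝓕 P) (hp : p = 1 ∨ p = 2) {x : ℝ}
    (hx : 0 ≤ x) : (meanPower B P p * x ^ p) ^ 2 ≤ x ^ (p + 2) := by
  rcases hp with rfl | rfl
  · rw [meanPower_one hB]
    simpa using by positivity
  · rw [meanPower_two hB]
    have : 0 ≤ x ^ 4 := by positivity
    nlinarith

/-- Combines `(J - m)² ≤ 2 J² + 2 m²` with Cauchy–Schwarz for `J` and `sq_weight_mul_pow_le` for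
`m`. -/
theorem sq_compensatedCell_le (hB : IsFilteredBrownian B 𝓕 P)
    (hθ_pos : ∀ ω, ∀ t ≤ T, 0 < θ t ω) (hp : p = 1 ∨ p = 2) {C d : ℝ}
    (hd : 0 ≤ d) (k : ℕ) (ω : Ω) :
    compensatedCell a θ B P T p n C d k ω ^ 2 ≤
      2 * cellEnergy a θ B T p n C d k ω + 2 * (C ^ 2 * d) * cellLength θ T n k ω := by
  rw [compensatedCell, cellEnergy]
  have h1 := sq_integral_increment_le hB p (gridPoint θ T n k) (cellLength θ T n k) ω
    (NNReal.coe_nonneg _) le_rfl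
  change cellIntegral B p _ _ ω ^ 2 ≤ _ at h1
  have h2 := sq_meanPower_mul_le hB hp (NNReal.coe_nonneg (cellLength θ T n k ω))
  have h3 := sq_weight_mul_pow_le (p := p) (n := n) (a := a) hθ_pos (C := C) hd k ω
  set w := weight a θ T p n C d k ω
  set J := cellIntegral B p (gridPoint θ T n k) (cellLength θ T n k) ω
  set m := meanPower B P p * (cellLength θ T n k ω : ℝ) ^ p
  calc (w * (J - m)) ^ 2 ≤ 2 * (w ^ 2 * J ^ 2) + 2 * (w ^ 2 * m ^ 2) := by
        nlinarith [sq_nonneg (w * J + w * m)]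
    _ ≤ 2 * (w ^ 2 * (cellLength θ T n k ω *
          cellIntegral B (2 * p) (gridPoint θ T n k) (cellLength θ T n k) ω)) +
        2 * (w ^ 2 * (cellLength θ T n k ω : ℝ) ^ (p + 2)) := by gcongr
    _ ≤ _ := by linarith

theorem memLp_compensatedCell (hB : IsFilteredBrownian B 𝓕 P)
    (ha : IsStronglyProgressive 𝓕 a) (hθ : IsStronglyProgressive 𝓕 θ)
    (hθ_pos : ∀ ω, ∀ t ≤ T, 0 < θ t ω) (hp : p = 1 ∨ p = 2) {C d : ℝ} (hC : 0 ≤ C) (hd : 0 ≤ d)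
    (k : ℕ) : MemLp (compensatedCell a θ B P T p n C d k) 2 P ∧
    ∫ ω, compensatedCell a θ B P T p n C d k ω ^ 2 ∂P ≤
      2 * (gaussMoment (2 * p) 1 + 1) * (C ^ 2 * d) * ∫ ω, (cellLength θ T n k ω : ℝ) ∂P := by
  have hE := integral_cellEnergy_le (p := p) (n := n) hB ha hθ hθ_pos hC hd k
  have hδ := integrable_cellLength (P := P) hθ T n k
  have hdom := (hE.1.const_mul 2).add (hδ.const_mul (2 * (C ^ 2 * d)))
  have hm := ((measurable_compensatedCell (p := p) (n := n) (T := T) hB ha hθ C d k).mono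
    ((gridFiltration hθ T n).le _)).aestronglyMeasurable (μ := P)
  have hint : Integrable (fun ω => compensatedCell a θ B P T p n C d k ω ^ 2) P :=
    hdom.mono' (hm.pow 2) (ae_of_all _ fun ω => by
      rw [Real.norm_of_nonneg (sq_nonneg _)]
      exact sq_compensatedCell_le hB hθ_pos hp hd k ω)
  refine ⟨(memLp_two_iff_integrable_sq hm).2 hint, ?_⟩
  calc _ ≤ ∫ ω, (2 * cellEnergy a θ B T p n C d k ω +
        2 * (C ^ 2 * d) * cellLength θ T n k ω) ∂P :=
        integral_mono hint hdom fun ω => sq_compensatedCell_le hB hθ_pos hp hd k ω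
    _ = 2 * (∫ ω, cellEnergy a θ B T p n C d k ω ∂P) +
        2 * (C ^ 2 * d) * ∫ ω, (cellLength θ T n k ω : ℝ) ∂P := by
        rw [integral_add (hE.1.const_mul 2) (hδ.const_mul _), integral_const_mul,
          integral_const_mul]
    _ ≤ _ := by linarith [hE.2]

/-- The martingale difference property: the weight times the indicator of `A` belongs to the past of
`τ_k`, and the subtracted term is exactly the conditional mean of the cell integral. -/
theorem setIntegral_compensatedCell (hB : IsFilteredBrownian B 𝓕 P)
    (ha : IsStronglyProgressive 𝓕 a) (hθ : IsStronglyProgressive 𝓕 θ) (hp : p = 1 ∨ p = 2)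
    {C : ℝ} (hC : 0 ≤ C) (d : ℝ) (k : ℕ) {A : Set Ω}
    (hA : MeasurableSet[gridFiltration hθ T n k] A) :
    ∫ ω in A, compensatedCell a θ B P T p n C d k ω ∂P = 0 := by
  have hX : Measurable[gridFiltration hθ T n k] (A.indicator (weight a θ T p n C d k)) :=
    Measurable.indicator (m := gridFiltration hθ T n k) (measurable_weight ha hθ T p n C d k) hA
  have hXK : ∀ ω, |A.indicator (weight a θ T p n C d k) ω| ≤ (n : ℝ) ^ ((p : ℝ) / 2) * C :=
    fun ω => by
      by_cases h : ω ∈ A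
      · rw [Set.indicator_of_mem h]
        exact abs_weight_le hC d k ω
      · rw [Set.indicator_of_notMem h, abs_zero]
        positivity
  have h := integral_mul_cellIntegral hB (isFiniteStopping_gridPoint hθ T n k)
    (measurable_cellLength hθ T n k) (cellLength_le θ T n k) p hX hXK
  simp_rw [integral_gaussMoment hB hp] at h
  have hle := (gridFiltration hθ T n).le k
  have hi : Integrable (fun ω => A.indicator (weight a θ T p n C d k) ω *
      (meanPower B P p * (cellLength θ T n k ω : ℝ) ^ p)) P := by
    have hm := (measurable_cellLength hθ T n k).mono hle le_rfl
    refine Integrable.of_bound ((hX.mono hle le_rfl).mul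
      ((hm.coe_nnreal_real.pow_const p).const_mul _)).aestronglyMeasurable
      ((n : ℝ) ^ ((p : ℝ) / 2) * C * (|meanPower B P p| * (T : ℝ) ^ p)) (ae_of_all _ fun ω => ?_)
    rw [norm_mul, norm_mul, norm_pow, Real.norm_of_nonneg (NNReal.coe_nonneg _)]
    gcongr
    · exact hXK ω
    · exact le_rfl
    · exact cellLength_le θ T n k ω
  rw [← integral_indicator (hle _ hA)]
  have he : A.indicator (compensatedCell a θ B P T p n C d k) = fun ω =>
      A.indicator (weight a θ T p n C d k) ω *
        cellIntegral B p (gridPoint θ T n k) (cellLength θ T n k) ω -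
      A.indicator (weight a θ T p n C d k) ω *
        (meanPower B P p * (cellLength θ T n k ω : ℝ) ^ p) := by
    funext ω
    by_cases hω : ω ∈ A
    · simp only [Set.indicator_of_mem hω, compensatedCell, mul_sub]
    · simp only [Set.indicator_of_notMem hω, zero_mul, sub_zero]
  rw [he, integral_sub h.1 hi, h.2, sub_self]

/-- The lengths telescope. As the number of cells is unbounded, every per-cell bound is kept
proportional to the cell length and summed through this inequality. -/
theorem sum_integral_cellLength_le (hθ : IsStronglyProgressive 𝓕 θ) (T : ℝ≥0) (n K : ℕ) :
    ∑ k ∈ Finset.range K, ∫ ω, (cellLength θ T n k ω : ℝ) ∂P ≤ T := by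
  rw [← integral_finsetSum _ fun k _ => integrable_cellLength hθ T n k]
  have hs : ∀ ω, ∑ k ∈ Finset.range K, (cellLength θ T n k ω : ℝ) ≤ T := fun ω => by
    simp_rw [← cellLength_eq_sub]
    rw [Finset.sum_range_sub (fun k => (gridPoint θ T n k ω : ℝ))]
    have : gridPoint θ T n K ω ≤ T := gridPoint_le θ T n K ω
    have : (gridPoint θ T n K ω : ℝ) ≤ T := by exact_mod_cast this
    simpa [gridPoint] using this
  calc _ ≤ ∫ _, (T : ℝ) ∂P := integral_mono
        (integrable_finsetSum _ fun k _ => integrable_cellLength hθ T n k)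
        (integrable_const _) hs
    _ = T := by simp

theorem measure_exists_le_abs_sum_compensatedCell (hB : IsFilteredBrownian B 𝓕 P)
    (ha : IsStronglyProgressive 𝓕 a) (hθ : IsStronglyProgressive 𝓕 θ)
    (hθ_pos : ∀ ω, ∀ t ≤ T, 0 < θ t ω) (hp : p = 1 ∨ p = 2) {C d : ℝ} (hC : 0 ≤ C) (hd : 0 ≤ d)
    (n : ℕ) {ε : ℝ} (hε : 0 < ε) :
    P {ω | ∃ K, ε ≤ |∑ k ∈ Finset.range K, compensatedCell a θ B P T p n C d k ω|} ≤
      ENNReal.ofReal (2 * (gaussMoment (2 * p) 1 + 1) * (C ^ 2 * d) * T / ε ^ 2) := by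
  refine measure_exists_le_abs_sum_le (𝓖 := gridFiltration hθ T n)
    (measurable_compensatedCell hB ha hθ C d)
    (fun k => (memLp_compensatedCell hB ha hθ hθ_pos hp hC hd k).1)
    (fun k A hA => setIntegral_compensatedCell hB ha hθ hp hC d k hA) (fun K => ?_) hε
  have h3 := gaussMoment_two_mul_nonneg p 1
  calc _ ≤ ∑ k ∈ Finset.range K, 2 * (gaussMoment (2 * p) 1 + 1) * (C ^ 2 * d) *
        ∫ ω, (cellLength θ T n k ω : ℝ) ∂P :=
        Finset.sum_le_sum fun k _ => (memLp_compensatedCell hB ha hθ hθ_pos hp hC hd k).2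
    _ ≤ _ := by
        rw [← Finset.mul_sum]
        exact mul_le_mul_of_nonneg_left (sum_integral_cellLength_le hθ T n K) (by positivity)

theorem cellEnergy_nonneg (C d : ℝ) (k : ℕ) (ω : Ω) : 0 ≤ cellEnergy a θ B T p n C d k ω := by
  refine mul_nonneg (by positivity) (intervalIntegral.integral_nonneg (NNReal.coe_nonneg _)
    fun u _ => ?_)
  rw [pow_mul]
  positivity

/-- Markov's inequality in each cell and a union bound over infinitely many cells. -/
theorem measure_exists_le_cellEnergy (hB : IsFilteredBrownian B 𝓕 P)
    (ha : IsStronglyProgressive 𝓕 a) (hθ : IsStronglyProgressive 𝓕 θ)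
    (hθ_pos : ∀ ω, ∀ t ≤ T, 0 < θ t ω) {C d : ℝ} (hC : 0 ≤ C) (hd : 0 ≤ d)
    (n : ℕ) {ε : ℝ} (hε : 0 < ε) :
    P {ω | ∃ k, ε ≤ cellEnergy a θ B T p n C d k ω} ≤
      ENNReal.ofReal (gaussMoment (2 * p) 1 * (C ^ 2 * d) * T / ε) := by
  have h3 := gaussMoment_two_mul_nonneg p 1
  have hk : ∀ k, P {ω | ε ≤ cellEnergy a θ B T p n C d k ω} ≤ ENNReal.ofReal
      (gaussMoment (2 * p) 1 * (C ^ 2 * d) / ε * ∫ ω, (cellLength θ T n k ω : ℝ) ∂P) := by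
    intro k
    have hE := integral_cellEnergy_le (p := p) (n := n) hB ha hθ hθ_pos hC hd k
    have hM := mul_meas_ge_le_integral_of_nonneg
      (ae_of_all _ fun ω => cellEnergy_nonneg C d k ω) hE.1 ε
    rw [← ofReal_measureReal]
    refine ENNReal.ofReal_le_ofReal ?_
    rw [div_mul_eq_mul_div, le_div_iff₀ hε, mul_comm]
    exact hM.trans hE.2
  have hU : {ω | ∃ k, ε ≤ cellEnergy a θ B T p n C d k ω} =
      ⋃ k, {ω | ε ≤ cellEnergy a θ B T p n C d k ω} := by
    ext ω
    simp
  rw [hU]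
  refine (measure_iUnion_le _).trans (ENNReal.tsum_le_of_sum_range_le fun K => ?_)
  refine (Finset.sum_le_sum fun k _ => hk k).trans ?_
  rw [← ENNReal.ofReal_sum_of_nonneg fun k _ => mul_nonneg (by positivity)
    (integral_nonneg fun ω => NNReal.coe_nonneg _), ← Finset.mul_sum,
    mul_div_right_comm (gaussMoment (2 * p) 1 * (C ^ 2 * d))]
  exact ENNReal.ofReal_le_ofReal
    (mul_le_mul_of_nonneg_left (sum_integral_cellLength_le hθ T n K) (by positivity))

end Grid

/-! ### Path properties, passage to deterministic constants, and fineness of the grid -/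

section Paths

variable {P : Measure Ω} {𝓕 : Filtration ℝ≥0 mΩ} {a θ B : ℝ≥0 → Ω → ℝ} {T : ℝ≥0} {p n : ℕ}

/-- Progressive measurability at time `T` gives joint measurability on `[0, T]`; freezing time at
`T` extends it to all times without changing integrals over `[0, T]`. -/
theorem measurable_min_of_progressive {u : ℝ≥0 → Ω → ℝ} (hu : IsStronglyProgressive 𝓕 u)
    (T : ℝ≥0) : Measurable fun q : ℝ≥0 × Ω => u (min q.1 T) q.2 := by
  have h := (hu T).measurable
  have hφ : Measurable[inferInstance, Subtype.instMeasurableSpace.prod (𝓕 T)]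
      fun q : ℝ≥0 × Ω => ((⟨min q.1 T, Set.mem_Iic.2 (min_le_right _ _)⟩ : Set.Iic T), q.2) :=
    @Measurable.prodMk _ _ _ _ _ (𝓕 T)
      (fun q : ℝ≥0 × Ω => (⟨min q.1 T, Set.mem_Iic.2 (min_le_right _ _)⟩ : Set.Iic T)) Prod.snd
      (measurable_fst.min measurable_const).subtype_mk (measurable_snd.mono le_rfl (𝓕.le T))
  exact h.comp hφ

theorem measurable_min_ratio (ha : IsStronglyProgressive 𝓕 a) (hθ : IsStronglyProgressive 𝓕 θ)
    (T : ℝ≥0) (p : ℕ) :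
    Measurable fun q : ℝ × Ω => ratio a θ p (min q.1.toNNReal T) q.2 := by
  have hm : Measurable fun q : ℝ × Ω => (q.1.toNNReal, q.2) :=
    measurable_fst.real_toNNReal.prodMk measurable_snd
  exact ((measurable_min_of_progressive ha T).comp hm).div
    (((measurable_min_of_progressive hθ T).comp hm).pow_const _)

theorem intervalIntegrable_of_bounded {f g : ℝ → ℝ} {T M : ℝ} (hT : 0 ≤ T) (hg : Measurable g)
    (hfg : ∀ s ∈ Set.Icc 0 T, f s = g s) (hM : ∀ s ∈ Set.Icc 0 T, |f s| ≤ M) :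
    IntervalIntegrable f volume 0 T := by
  rw [intervalIntegrable_iff_integrableOn_Ioc_of_le hT]
  refine IntegrableOn.congr_fun (f := g) ?_
    (fun s hs => (hfg s (Set.Ioc_subset_Icc_self hs)).symm) measurableSet_Ioc
  refine Measure.integrableOn_of_bounded (M := M) measure_Ioc_lt_top.ne hg.aestronglyMeasurable ?_
  refine (ae_restrict_iff' measurableSet_Ioc).2 (ae_of_all _ fun s hs => ?_)
  have hs' := Set.Ioc_subset_Icc_self hs
  rw [← hfg s hs']
  exact hM s hs'

theorem min_toNNReal_eq {s : ℝ} (hs : s ∈ Set.Icc 0 (T : ℝ)) : min s.toNNReal T = s.toNNReal :=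
  min_eq_left (Real.toNNReal_le_iff_le_coe.2 hs.2)

theorem intervalIntegrable_ratio (ha : IsStronglyProgressive 𝓕 a)
    (hθ : IsStronglyProgressive 𝓕 θ) {ω : Ω}
    (h : RiemannIntegrableOn (fun s => ratio a θ p s.toNNReal ω) 0 T) :
    IntervalIntegrable (fun s => ratio a θ p s.toNNReal ω) volume 0 T := by
  obtain ⟨⟨M, hM⟩, -⟩ := h
  refine intervalIntegrable_of_bounded T.coe_nonneg
    ((measurable_min_ratio ha hθ T p).comp (measurable_prodMk_right (y := ω))) (fun s hs => ?_) hM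
  simp only [Function.comp_apply, min_toNNReal_eq hs]

theorem measurable_psi (hB : ∀ ω, Continuous fun t => B t ω) (ω : Ω) :
    Measurable fun t => psi a θ B T p n t ω := by
  refine Measurable.const_mul (Measurable.tsum fun k => Measurable.indicator ?_
    measurableSet_Ico) _
  exact (((hB ω).measurable.sub_const _).pow_const p).const_mul _

theorem abs_cellFun_le {α : Type*} [LinearOrder α] {t : ℕ → α} (ht : Monotone t)
    {f : ℕ → α → ℝ} {s : α} (h0 : t 0 ≤ s) {M : ℝ} (hM0 : 0 ≤ M)
    (hM : ∀ k, t k ≤ s → |f k s| ≤ M) : |cellFun t f s| ≤ M := by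
  rcases exists_mem_cell_or_forall_le h0 with ⟨k, hk⟩ | hall
  · rw [cellFun_of_mem ht f hk]
    exact hM k hk.1
  · rw [cellFun_of_forall_le f hall, abs_zero]
    exact hM0

theorem psi_eq_cellFun (t : ℝ≥0) (ω : Ω) : psi a θ B T p n t ω = (n : ℝ) ^ ((p : ℝ) / 2) *
    cellFun (fun k => gridPoint θ T n k ω) (fun k t =>
      a (gridPoint θ T n k ω) ω * (B t ω - B (gridPoint θ T n k ω) ω) ^ p) t := rfl

theorem intervalIntegrable_psi (hB : ∀ ω, Continuous fun t => B t ω) {ω : Ω}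
    (ha : ∃ C : ℝ, ∀ t ≤ T, |a t ω| ≤ C) :
    IntervalIntegrable (fun s => psi a θ B T p n s.toNNReal ω) volume 0 T := by
  obtain ⟨C, hC⟩ := ha
  have hC0 : 0 ≤ C := (abs_nonneg _).trans (hC 0 zero_le)
  obtain ⟨K, hK⟩ := (isCompact_Icc (a := (0 : ℝ≥0)) (b := T)).exists_bound_of_continuousOn
    (hB ω).continuousOn
  have hK0 : 0 ≤ K := (norm_nonneg _).trans (hK 0 ⟨le_rfl, zero_le⟩)
  refine intervalIntegrable_of_bounded (M := (n : ℝ) ^ ((p : ℝ) / 2) * (C * (2 * K) ^ p))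
    T.coe_nonneg ((measurable_psi hB ω).comp measurable_real_toNNReal) (fun s _ => rfl)
    fun s hs => ?_
  have hn : (0 : ℝ) ≤ (n : ℝ) ^ ((p : ℝ) / 2) := by positivity
  rw [psi_eq_cellFun, abs_mul, abs_of_nonneg hn]
  refine mul_le_mul_of_nonneg_left ?_ hn
  refine abs_cellFun_le (monotone_gridPoint θ T n ω) zero_le (by positivity) fun k _ => ?_
  rw [abs_mul, abs_pow]
  have hk := gridPoint_le θ T n k ω
  have h1 : |B s.toNNReal ω - B (gridPoint θ T n k ω) ω| ≤ 2 * K := by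
    refine (abs_sub _ _).trans ?_
    have h1 := hK s.toNNReal ⟨zero_le, Real.toNNReal_le_iff_le_coe.2 hs.2⟩
    have h2 := hK (gridPoint θ T n k ω) ⟨zero_le, hk⟩
    rw [Real.norm_eq_abs] at h1 h2
    linarith
  exact mul_le_mul (hC _ hk) (pow_le_pow_left₀ (abs_nonneg _) h1 p) (by positivity) hC0

theorem integral_psi_cell (k : ℕ) (ω : Ω) {s : ℝ}
    (hs : s ∈ Set.Icc (gridPoint θ T n k ω : ℝ) (gridPoint θ T n (k + 1) ω)) :
    ∫ u in (gridPoint θ T n k ω : ℝ)..s, psi a θ B T p n u.toNNReal ω =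
      (n : ℝ) ^ ((p : ℝ) / 2) * a (gridPoint θ T n k ω) ω *
        ∫ u in (0 : ℝ)..(s - gridPoint θ T n k ω),
          (B (gridPoint θ T n k ω + u.toNNReal) ω - B (gridPoint θ T n k ω) ω) ^ p := by
  set τ := gridPoint θ T n k ω with hτ
  have h1 : ∫ u in (τ : ℝ)..s, psi a θ B T p n u.toNNReal ω =
      ∫ u in (τ : ℝ)..s, (n : ℝ) ^ ((p : ℝ) / 2) * a τ ω * (B u.toNNReal ω - B τ ω) ^ p := by
    -- The right end of the cell belongs to the next one, so the integrands are compared on the open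
    -- interval only.
    rw [intervalIntegral.integral_of_le hs.1, intervalIntegral.integral_of_le hs.1,
      integral_Ioc_eq_integral_Ioo, integral_Ioc_eq_integral_Ioo]
    refine setIntegral_congr_fun measurableSet_Ioo fun u hu => ?_
    have hmem : u.toNNReal ∈ Set.Ico (gridPoint θ T n k ω) (gridPoint θ T n (k + 1) ω) :=
      ⟨NNReal.le_toNNReal_of_coe_le hu.1.le,
        (Real.toNNReal_lt_iff_lt_coe (τ.coe_nonneg.trans hu.1.le)).2 (hu.2.trans_le hs.2)⟩
    rw [psi_eq_cellFun, cellFun_of_mem (monotone_gridPoint θ T n ω) _ hmem, mul_assoc]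
  rw [h1, intervalIntegral.integral_const_mul]
  congr 1
  have h2 := intervalIntegral.integral_comp_add_left
    (fun u => (B u.toNNReal ω - B τ ω) ^ p) (a := 0) (b := s - τ) (τ : ℝ)
  rw [add_zero, add_sub_cancel] at h2
  rw [← h2]
  refine intervalIntegral.integral_congr fun u hu => ?_
  rw [Set.uIcc_of_le (sub_nonneg.2 hs.1)] at hu
  rw [Real.toNNReal_add τ.coe_nonneg hu.1, Real.toNNReal_coe]

theorem psi_eq_zero {s : ℝ} {ω : Ω} (hs : ∀ k, (gridPoint θ T n k ω : ℝ) ≤ s) :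
    psi a θ B T p n s.toNNReal ω = 0 := by
  rw [psi_eq_cellFun, cellFun_of_forall_le, mul_zero]
  exact fun k => NNReal.le_toNNReal_of_coe_le (hs k)

/-- When `ν ≥ T` the stopped process is the process itself on `[0, T]`, so unbounded paths have
probability at most `ε` for every `ε`. -/
theorem LocallyBoundedOn.ae_bounded (h : LocallyBoundedOn a 𝓕 P T) :
    ∀ᵐ ω ∂P, ∃ C : ℝ, ∀ t ≤ T, |a t ω| ≤ C := by
  rw [ae_iff]
  refine le_antisymm (le_of_forall_pos_le_add fun ε hε => ?_) zero_le
  obtain ⟨ν, -, hν, C, hC⟩ := h ε hε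
  have hsub : {ω | ¬ ∃ C : ℝ, ∀ t ≤ T, |a t ω| ≤ C} ⊆ {ω | ν ω < (T : WithTop ℝ≥0)} ∪
      {ω | ¬ ∀ t ≤ T, |a (min (t : WithTop ℝ≥0) (ν ω)).untopA ω| ≤ C} := by
    intro ω hω
    by_contra hcon
    simp only [Set.mem_union, Set.mem_ofPred_eq, not_or, not_lt, not_not] at hcon
    refine hω ⟨C, fun t ht => ?_⟩
    have := hcon.2 t ht
    rwa [min_eq_left ((WithTop.coe_le_coe.2 ht).trans hcon.1)] at this
  refine (measure_mono hsub).trans ((measure_union_le _ _).trans ?_)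
  rw [ae_iff.1 hC, add_zero, zero_add]
  exact hν.le

/-- Continuity from above: an almost surely finite random threshold becomes a deterministic one
outside an event of probability at most `κ`. -/
theorem exists_measure_le_of_antitone [IsFiniteMeasure P] {S : ℕ → Set Ω}
    (hS : ∀ m, MeasurableSet (S m)) (hanti : Antitone S) (hae : ∀ᵐ ω ∂P, ∃ m, ω ∉ S m)
    {κ : ℝ≥0∞} (hκ : 0 < κ) : ∃ m, P (S m) ≤ κ := by
  have hlim := tendsto_measure_iInter_atTop (μ := P) (fun m => (hS m).nullMeasurableSet) hanti
    ⟨0, measure_ne_top _ _⟩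
  have h0 : P (⋂ m, S m) = 0 := by
    refine measure_mono_null (fun ω hω => ?_) (ae_iff.1 hae)
    simpa using hω
  rw [h0] at hlim
  exact (ENNReal.tendsto_nhds_zero.1 hlim κ hκ).exists

/-- Intended for values along grid points: countably many variables keep the event measurable, which
a supremum over all times need not be. -/
theorem exists_measure_exists_gt_le [IsFiniteMeasure P] {Y : ℕ → ℕ → Ω → ℝ}
    (hY : ∀ n k, Measurable (Y n k)) (hae : ∀ᵐ ω ∂P, ∃ C : ℝ, ∀ n k, |Y n k ω| ≤ C)
    {κ : ℝ≥0∞} (hκ : 0 < κ) : ∃ C : ℝ, 0 ≤ C ∧ P {ω | ∃ n k, C < |Y n k ω|} ≤ κ := by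
  suffices h : ∃ m : ℕ, P {ω | ∃ n k, (m : ℝ) < |Y n k ω|} ≤ κ from
    h.elim fun m hm => ⟨m, Nat.cast_nonneg m, hm⟩
  refine exists_measure_le_of_antitone (P := P)
    (S := fun m : ℕ => {ω | ∃ n k, (m : ℝ) < |Y n k ω|}) (fun m => ?_) ?_ ?_ hκ
  · have : {ω | ∃ n k, (m : ℝ) < |Y n k ω|} = ⋃ n, ⋃ k, {ω | (m : ℝ) < |Y n k ω|} := by
      ext ω
      simp
    rw [this]
    exact MeasurableSet.iUnion fun n => MeasurableSet.iUnion fun k =>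
      measurableSet_lt measurable_const (measurable_norm.comp (hY n k))
  · rintro m m' hm ω ⟨n, k, h⟩
    exact ⟨n, k, (Nat.cast_le.2 hm).trans_lt h⟩
  · filter_upwards [hae] with ω ⟨C, hC⟩
    obtain ⟨m, hm⟩ := exists_nat_ge C
    refine ⟨m, ?_⟩
    rintro ⟨n, k, h⟩
    exact absurd h (not_lt.2 ((hC n k).trans hm))

/-- The cells of the `n`-th grid are no longer than `d`, and the grid comes within `d` of `T`. -/
def fineGridSet (θ : ℝ≥0 → Ω → ℝ) (T : ℝ≥0) (n : ℕ) (d : ℝ) : Set Ω :=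
  {ω | (∀ k, (cellLength θ T n k ω : ℝ) ≤ d) ∧ ∃ k, (T : ℝ) - gridPoint θ T n k ω ≤ d}

theorem measurableSet_fineGridSet (hθ : IsStronglyProgressive 𝓕 θ) (T : ℝ≥0) (n : ℕ) (d : ℝ) :
    MeasurableSet (fineGridSet θ T n d) := by
  have he : fineGridSet θ T n d = (⋂ k, {ω | (cellLength θ T n k ω : ℝ) ≤ d}) ∩
      ⋃ k, {ω | (T : ℝ) - gridPoint θ T n k ω ≤ d} := by
    ext ω
    simp [fineGridSet]
  have hle := fun k => (gridFiltration hθ T n).le k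
  rw [he]
  refine (MeasurableSet.iInter fun k => measurableSet_le ?_ measurable_const).inter
    (MeasurableSet.iUnion fun k => measurableSet_le (measurable_const.sub ?_) measurable_const)
  · exact ((measurable_cellLength hθ T n k).mono (hle k) le_rfl).coe_nnreal_real
  · exact ((measurable_gridPoint hθ T n k).mono (hle k) le_rfl).coe_nnreal_real

/-- The `L¹` distance on `[0, T]` between `a / θ^(p/2)` and its left-point step function along the
`n`-th grid. -/
def stepError (a θ : ℝ≥0 → Ω → ℝ) (T : ℝ≥0) (p n : ℕ) (ω : Ω) : ℝ≥0∞ :=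
  ∫⁻ s in Set.Ioc 0 (T : ℝ), ‖ratio a θ p s.toNNReal ω -
    cellFun (fun k => (gridPoint θ T n k ω : ℝ))
      (fun k _ => ratio a θ p (gridPoint θ T n k ω : ℝ).toNNReal ω) s‖ₑ

theorem measurable_cellFun_ratio (ha : IsStronglyProgressive 𝓕 a)
    (hθ : IsStronglyProgressive 𝓕 θ) (T : ℝ≥0) (p n : ℕ) :
    Measurable fun q : ℝ × Ω => cellFun (fun k => (gridPoint θ T n k q.2 : ℝ))
      (fun k _ => ratio a θ p (gridPoint θ T n k q.2 : ℝ).toNNReal q.2) q.1 := by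
  have hle := fun k => (gridFiltration hθ T n).le k
  have hg : ∀ k, Measurable fun q : ℝ × Ω => (gridPoint θ T n k q.2 : ℝ) := fun k =>
    (((measurable_gridPoint hθ T n k).mono (hle k) le_rfl).comp measurable_snd).coe_nnreal_real
  have he : (fun q : ℝ × Ω => cellFun (fun k => (gridPoint θ T n k q.2 : ℝ))
      (fun k _ => ratio a θ p (gridPoint θ T n k q.2 : ℝ).toNNReal q.2) q.1) = fun q =>
      ∑' k, {q : ℝ × Ω | (gridPoint θ T n k q.2 : ℝ) ≤ q.1 ∧
        q.1 < gridPoint θ T n (k + 1) q.2}.indicator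
        (fun q => ratio a θ p (gridPoint θ T n k q.2) q.2) q := by
    funext q
    simp only [Real.toNNReal_coe]
    rfl
  rw [he]
  refine Measurable.tsum fun k => Measurable.indicator ?_
    ((measurableSet_le (hg k) measurable_fst).inter (measurableSet_lt measurable_fst (hg (k + 1))))
  exact ((measurable_gridPoint_ratio ha hθ T p n k).mono (hle k) le_rfl).comp measurable_snd

theorem measurable_stepError (ha : IsStronglyProgressive 𝓕 a)
    (hθ : IsStronglyProgressive 𝓕 θ) (T : ℝ≥0) (p n : ℕ) :
    Measurable (stepError a θ T p n) := by
  have he : stepError a θ T p n = fun ω => ∫⁻ s in Set.Ioc 0 (T : ℝ),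
      ‖ratio a θ p (min s.toNNReal T) ω - cellFun (fun k => (gridPoint θ T n k ω : ℝ))
      (fun k _ => ratio a θ p (gridPoint θ T n k ω : ℝ).toNNReal ω) s‖ₑ := by
    funext ω
    refine setLIntegral_congr_fun measurableSet_Ioc fun s hs => ?_
    simp only [min_toNNReal_eq (Set.Ioc_subset_Icc_self hs)]
  rw [he]
  exact Measurable.lintegral_prod_left'
    ((measurable_min_ratio ha hθ T p).sub (measurable_cellFun_ratio ha hθ T p n)).enorm

/-- The mesh threshold from Riemann integrability depends on the path but is valid for all grids,
hence for all `n` at once; it is made deterministic along the meshes `1 / (m + 1)`. -/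
theorem exists_measure_stepError_le [IsFiniteMeasure P] (ha : IsStronglyProgressive 𝓕 a)
    (hθ : IsStronglyProgressive 𝓕 θ)
    (hR : ∀ᵐ ω ∂P, RiemannIntegrableOn (fun s => ratio a θ p s.toNNReal ω) 0 T)
    {ε : ℝ} (hε : 0 < ε) {κ : ℝ≥0∞} (hκ : 0 < κ) :
    ∃ δ : ℝ, 0 < δ ∧ P {ω | ∃ n, ∃ d ≤ δ, ω ∈ fineGridSet θ T n d ∧
      ENNReal.ofReal ε < stepError a θ T p n ω} ≤ κ := by
  have hmono : ∀ n {d d' : ℝ}, d ≤ d' → fineGridSet θ T n d ⊆ fineGridSet θ T n d' :=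
    fun n d d' h ω hω => ⟨fun k => (hω.1 k).trans h, hω.2.imp fun k hk => hk.trans h⟩
  suffices h : ∃ m : ℕ, P {ω | ∃ n, ω ∈ fineGridSet θ T n (1 / ((m : ℝ) + 1)) ∧
      ENNReal.ofReal ε < stepError a θ T p n ω} ≤ κ by
    obtain ⟨m, hm⟩ := h
    refine ⟨1 / ((m : ℝ) + 1), by positivity, le_trans (measure_mono ?_) hm⟩
    rintro ω ⟨n, d, hd, h1, h2⟩
    exact ⟨n, hmono n hd h1, h2⟩
  refine exists_measure_le_of_antitone (P := P) (S := fun m : ℕ =>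
    {ω | ∃ n, ω ∈ fineGridSet θ T n (1 / ((m : ℝ) + 1)) ∧
      ENNReal.ofReal ε < stepError a θ T p n ω}) (fun m => ?_) ?_ ?_ hκ
  · have he : {ω | ∃ n, ω ∈ fineGridSet θ T n (1 / ((m : ℝ) + 1)) ∧
        ENNReal.ofReal ε < stepError a θ T p n ω} = ⋃ n, (fineGridSet θ T n (1 / ((m : ℝ) + 1)) ∩
          {ω | ENNReal.ofReal ε < stepError a θ T p n ω}) := by
      ext ω
      simp
    rw [he]
    exact MeasurableSet.iUnion fun n => (measurableSet_fineGridSet hθ T n _).inter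
      (measurableSet_lt measurable_const (measurable_stepError ha hθ T p n))
  · rintro m m' hm ω ⟨n, h1, h2⟩
    refine ⟨n, hmono n ?_ h1, h2⟩
    gcongr
  · filter_upwards [hR] with ω hω
    obtain ⟨δ, hδ, h⟩ := hω.exists_forall_lintegral_sub_step_le T.coe_nonneg hε
    obtain ⟨m, hm⟩ := exists_nat_one_div_lt hδ
    refine ⟨m, ?_⟩
    rintro ⟨n, hn, hlt⟩
    have hn' := hmono n hm.le hn
    refine absurd hlt (not_lt.2 (h (fun k => (gridPoint θ T n k ω : ℝ)) ?_ ?_ ?_ ?_ ?_))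
    · exact fun i j hij => NNReal.coe_le_coe.2 (monotone_gridPoint θ T n ω hij)
    · simp [gridPoint]
    · exact fun k => NNReal.coe_le_coe.2 (gridPoint_le θ T n k ω)
    · intro k
      simp only [cellLength_eq_sub]
      exact hn'.1 k
    · exact hn'.2

/-- Finitely many test times `x j = j T / m`, spaced by at most `d / 3`, suffice. A cell longer than
`d` contains a test time whose last grid point lags by at least `d / 3`, and the last test time
before `T` forces a grid point near `T`. -/
theorem tendsto_measure_compl_fineGridSet
    (hη : ∀ t < T, TendstoInMeasure P
      (fun (n : ℕ) ω => lastGridPoint θ T n t ω) atTop (fun _ => t)) {d : ℝ} (hd : 0 < d) :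
    Tendsto (fun n => P (fineGridSet θ T n d)ᶜ) atTop (𝓝 0) := by
  rcases (zero_le (a := T)).eq_or_lt with hT | hT
  · have : ∀ n, (fineGridSet θ T n d)ᶜ = ∅ := fun n => by
      rw [Set.compl_empty_iff, Set.eq_univ_iff_forall]
      refine fun ω => ⟨fun k => ?_, 0, ?_⟩
      · have h := cellLength_le θ T n k ω
        rw [← hT] at h
        rw [← hT, le_zero_iff.1 h]
        exact hd.le
      · simp [← hT, gridPoint, hd.le]
    simp [this]
  have hT' : (0 : ℝ) < T := hT
  obtain ⟨m, hm⟩ := exists_nat_gt (3 * (T : ℝ) / d)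
  have hm0 : (0 : ℝ) < m := lt_of_le_of_lt (by positivity) hm
  have hmesh : (T : ℝ) / m ≤ d / 3 := by
    rw [div_lt_iff₀ hd] at hm
    rw [div_le_iff₀ hm0]
    linarith
  set x : ℕ → ℝ≥0 := fun j => j * T / m with hx
  have hxT : ∀ j < m, x j < T := fun j hj => by
    have hj' : (j : ℝ) < m := by exact_mod_cast hj
    rw [← NNReal.coe_lt_coe]
    simp only [hx]
    push_cast
    rw [div_lt_iff₀ hm0]
    nlinarith
  have hsub : ∀ n, (fineGridSet θ T n d)ᶜ ⊆ ⋃ j ∈ Finset.range m,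
      {ω | ENNReal.ofReal (d / 3) ≤ edist (lastGridPoint θ T n (x j) ω) (x j)} := by
    intro n ω hω
    by_contra hcon
    simp only [Finset.mem_range, Set.mem_iUnion, Set.mem_ofPred_eq, exists_prop, not_exists,
      not_and, not_le] at hcon
    have hgood : ∀ j < m, (x j : ℝ) - d / 3 < lastGridPoint θ T n (x j) ω := by
      intro j hj
      have h := hcon j hj
      rw [edist_dist, ENNReal.ofReal_lt_ofReal_iff (by positivity), NNReal.dist_eq, abs_lt] at h
      linarith [h.1]
    refine hω ⟨fun k => ?_, ?_⟩
    · by_contra hk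
      rw [not_le, ← cellLength_eq_sub] at hk
      set τ := gridPoint θ T n k ω with hτ
      set τ' := gridPoint θ T n (k + 1) ω with hτ'
      have hτT : (τ' : ℝ) ≤ T := NNReal.coe_le_coe.2 (gridPoint_le θ T n (k + 1) ω)
      -- The first test time at or after `τ + d / 3`; it precedes `τ + 2 d / 3`, hence still lies in
      -- the long cell.
      set j := ⌈(τ + d / 3) * m / T⌉₊ with hj
      have hnn : 0 ≤ ((τ : ℝ) + d / 3) * m / T := by positivity
      have hj1 : ((τ : ℝ) + d / 3) * m / T ≤ j := Nat.le_ceil _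
      have hj2 : (j : ℝ) < (τ + d / 3) * m / T + 1 := Nat.ceil_lt_add_one hnn
      have hxj : (x j : ℝ) = j * T / m := by simp [hx]
      have h1 : (τ : ℝ) + d / 3 ≤ x j := by
        rw [div_le_iff₀ hT'] at hj1
        rw [hxj, le_div_iff₀ hm0]
        exact hj1
      have h2 : (x j : ℝ) < τ + d / 3 + T / m := by
        rw [hxj, div_lt_iff₀ hm0, add_mul, div_mul_cancel₀ _ hm0.ne']
        have : (j : ℝ) * T < ((τ + d / 3) * m / T + 1) * T := by gcongr
        rwa [add_mul, div_mul_cancel₀ _ hT'.ne', one_mul] at this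
      have h3 : (x j : ℝ) < τ' := by linarith
      have hjm : j < m := by
        have : (x j : ℝ) < T := h3.trans_le hτT
        rw [hxj, div_lt_iff₀ hm0, mul_comm] at this
        exact_mod_cast lt_of_mul_lt_mul_left this hT'.le
      have h4 : lastGridPoint θ T n (x j) ω ≤ τ := by
        refine csSup_le' ?_
        rintro s ⟨hs, i, rfl⟩
        refine monotone_gridPoint θ T n ω (Nat.lt_succ_iff.1 ?_)
        by_contra hi
        have := monotone_gridPoint θ T n ω (not_lt.1 hi)
        exact absurd (NNReal.coe_lt_coe.1 h3) (not_lt.2 (this.trans hs))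
      have h5 : (lastGridPoint θ T n (x j) ω : ℝ) ≤ τ := NNReal.coe_le_coe.2 h4
      linarith [hgood j hjm]
    · have hm1 : m - 1 < m := Nat.sub_lt (by exact_mod_cast hm0) one_pos
      have h1 := hgood (m - 1) hm1
      have hxm : (x (m - 1) : ℝ) = T - T / m := by
        have hm' : 1 ≤ m := by exact_mod_cast hm0
        simp only [hx, NNReal.coe_div, NNReal.coe_mul, NNReal.coe_natCast]
        rw [Nat.cast_sub hm', Nat.cast_one]
        field_simp
      by_contra hcon'
      simp only [not_exists, not_le] at hcon'
      have h2 : (lastGridPoint θ T n (x (m - 1)) ω : ℝ) ≤ T - d := by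
        have hdT : 0 ≤ (T : ℝ) - d := by
          have := hcon' 0
          simp only [gridPoint, NNReal.coe_zero] at this
          linarith [hcon' 0, (gridPoint θ T n 0 ω).coe_nonneg]
        have : lastGridPoint θ T n (x (m - 1)) ω ≤ NNReal.mk ((T : ℝ) - d) hdT := by
          refine csSup_le' ?_
          rintro s ⟨hs, i, rfl⟩
          rw [← NNReal.coe_le_coe]
          have := hcon' i
          change _ ≤ (T : ℝ) - d
          linarith
        exact NNReal.coe_le_coe.2 this
      linarith
  have hlim : Tendsto (fun n => ∑ j ∈ Finset.range m,
      P {ω | ENNReal.ofReal (d / 3) ≤ edist (lastGridPoint θ T n (x j) ω) (x j)}) atTop (𝓝 0) := by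
    have := tendsto_finsetSum (Finset.range m) fun j hj =>
      hη (x j) (hxT j (Finset.mem_range.1 hj)) (ENNReal.ofReal (d / 3))
        (ENNReal.ofReal_pos.2 (by positivity))
    simpa using this
  exact tendsto_of_tendsto_of_tendsto_of_le_of_le tendsto_const_nhds hlim (fun _ => zero_le)
    fun n => (measure_mono (hsub n)).trans (measure_biUnion_finset_le _ _)

end Paths

/-! ### Compensators against Riemann sums, and the choice of constants -/

section Convergence

variable {P : Measure Ω} {𝓕 : Filtration ℝ≥0 mΩ} {a θ B : ℝ≥0 → Ω → ℝ} {T : ℝ≥0} {p n : ℕ}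
  {C d : ℝ}

theorem weight_of_mem {k : ℕ} {ω : Ω} (h : ω ∈ controlSet a θ T p n C d k) :
    weight a θ T p n C d k ω = (n : ℝ) ^ ((p : ℝ) / 2) * a (gridPoint θ T n k ω) ω :=
  Set.indicator_of_mem h _

theorem mul_cellLength_eq_one_or (hn : 0 < n) (hθ_pos : ∀ ω, ∀ t ≤ T, 0 < θ t ω) (k : ℕ) (ω : Ω) :
    n * θ (gridPoint θ T n k ω) ω * cellLength θ T n k ω = 1 ∨ gridPoint θ T n (k + 1) ω = T := by
  have hθ := hθ_pos ω _ (gridPoint_le θ T n k ω)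
  have hpos : 0 < n * θ (gridPoint θ T n k ω) ω := by positivity
  rcases min_choice (Real.toNNReal (1 / (n * θ (gridPoint θ T n k ω) ω)))
    (T - gridPoint θ T n k ω) with h | h
  · left
    rw [cellLength, h, Real.coe_toNNReal _ (by positivity)]
    field_simp
  · right
    rw [gridPoint_succ, cellLength, h, add_tsub_cancel_of_le (gridPoint_le θ T n k ω)]

/-- The summand vanishes on complete cells, where `n θ δ = 1`, and on the empty cells after `T` is
reached. Only the cell that first reaches `T` can contribute, which is the invariant recorded by the
`if`. -/
theorem sum_lastCell_le (hn : 0 < n) (hθ_pos : ∀ ω, ∀ t ≤ T, 0 < θ t ω) (hC : 0 ≤ C)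
    {ω : Ω} (hδ : ∀ k, (cellLength θ T n k ω : ℝ) ≤ d) (K : ℕ) :
    ∑ k ∈ Finset.range K, C * cellLength θ T n k ω *
      (1 - n * θ (gridPoint θ T n k ω) ω * cellLength θ T n k ω) ≤
      if gridPoint θ T n K ω = T then C * d else 0 := by
  have hd : 0 ≤ d := (NNReal.coe_nonneg _).trans (hδ 0)
  have hnn : ∀ k, 0 ≤ C * cellLength θ T n k ω := fun k => mul_nonneg hC (NNReal.coe_nonneg _)
  induction K with
  | zero =>
    rw [Finset.sum_range_zero]
    split_ifs
    · positivity
    · exact le_rfl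
  | succ K ih =>
    rw [Finset.sum_range_succ]
    by_cases h : gridPoint θ T n K ω = T
    · have h0 : cellLength θ T n K ω = 0 := by
        rw [cellLength, h, tsub_self, min_eq_right zero_le]
      rw [gridPoint_succ, h, h0, add_zero, if_pos rfl]
      rw [if_pos h] at ih
      simpa using ih
    · rw [if_neg h] at ih
      by_cases h' : gridPoint θ T n (K + 1) ω = T
      · rw [if_pos h']
        have h1 : C * cellLength θ T n K ω *
            (1 - n * θ (gridPoint θ T n K ω) ω * cellLength θ T n K ω) ≤ C * d := by
          have hθ := hθ_pos ω _ (gridPoint_le θ T n K ω)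
          have h2 : 0 ≤ n * θ (gridPoint θ T n K ω) ω * cellLength θ T n K ω := by positivity
          exact (mul_le_of_le_one_right (hnn K) (by linarith)).trans
            (mul_le_mul_of_nonneg_left (hδ K) hC)
        linarith
      · rw [if_neg h', ((mul_cellLength_eq_one_or hn hθ_pos K ω).resolve_right h')]
        simpa using ih

/-- For `p = 2` the compensator is `(a/θ) δ / 2` times `n θ δ`, so the discrepancy carries the
factor `1 - n θ δ`; for `p = 1` both terms are zero. -/
theorem abs_compensator_sub_le (hB : IsFilteredBrownian B 𝓕 P) [IsProbabilityMeasure P]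
    (hθ_pos : ∀ ω, ∀ t ≤ T, 0 < θ t ω) (hp : p = 1 ∨ p = 2) (hC : 0 ≤ C) {k : ℕ} {ω : Ω}
    (h : ω ∈ controlSet a θ T p n C d k) :
    |weight a θ T p n C d k ω * (meanPower B P p * (cellLength θ T n k ω : ℝ) ^ p) -
      meanPower B P p * (ratio a θ p (gridPoint θ T n k ω) ω * cellLength θ T n k ω)| ≤
      C * cellLength θ T n k ω *
        (1 - n * θ (gridPoint θ T n k ω) ω * cellLength θ T n k ω) := by
  have hle := mul_cellLength_le_one (n := n) hθ_pos k ω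
  have hθ := hθ_pos ω _ (gridPoint_le θ T n k ω)
  have hr := (h k le_rfl).2.1
  rw [weight_of_mem h]
  set δ : ℝ := NNReal.toReal (cellLength θ T n k ω)
  have hδ : 0 ≤ δ := NNReal.coe_nonneg _
  set x := gridPoint θ T n k ω
  rcases hp with rfl | rfl
  · rw [meanPower_one hB]
    simpa using mul_nonneg (mul_nonneg hC hδ) (sub_nonneg.2 hle)
  · rw [meanPower_two hB]
    have h2 : ((2 : ℕ) : ℝ) / 2 = 1 := by norm_num
    have he : (n : ℝ) ^ (((2 : ℕ) : ℝ) / 2) * a x ω * (1 / 2 * δ ^ 2) -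
        1 / 2 * (ratio a θ 2 x ω * δ) =
        -(1 / 2 * (ratio a θ 2 x ω * (δ * (1 - n * θ x ω * δ)))) := by
      rw [ratio, h2, Real.rpow_one, Real.rpow_one]
      field_simp
      ring
    have hz : 0 ≤ δ * (1 - n * θ x ω * δ) := mul_nonneg hδ (sub_nonneg.2 hle)
    rw [he, abs_neg, abs_mul, abs_mul, abs_of_nonneg hz, abs_of_pos (by norm_num : (0 : ℝ) < 1 / 2),
      mul_assoc]
    have := mul_le_mul_of_nonneg_right hr hz
    have := mul_nonneg (abs_nonneg (ratio a θ 2 x ω)) hz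
    linarith

/-- The pathwise estimate on the event that the grid is fine and the fluctuations are small. -/
theorem abs_integral_psi_sub_le (hB : IsFilteredBrownian B 𝓕 P) [IsProbabilityMeasure P]
    (ha : IsStronglyProgressive 𝓕 a) (hθ : IsStronglyProgressive 𝓕 θ) (hn : 0 < n)
    (hθ_pos : ∀ ω, ∀ t ≤ T, 0 < θ t ω) (hp : p = 1 ∨ p = 2) (hC : 0 ≤ C) {ε : ℝ} (hε : 0 ≤ ε)
    (hCd : C * d ≤ ε) {ω : Ω}
    (hR : RiemannIntegrableOn (fun s => ratio a θ p s.toNNReal ω) 0 T)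
    (hab : ∃ K : ℝ, ∀ t ≤ T, |a t ω| ≤ K) (hctrl : ∀ k, ω ∈ controlSet a θ T p n C d k)
    (hM : ∀ K, |∑ k ∈ Finset.range K, compensatedCell a θ B P T p n C d k ω| ≤ ε)
    (hE : ∀ k, cellEnergy a θ B T p n C d k ω ≤ ε ^ 2)
    (hS : stepError a θ T p n ω ≤ ENNReal.ofReal ε) {t : ℝ} (ht : t ∈ Set.Icc 0 (T : ℝ)) :
    |(∫ s in (0 : ℝ)..t, psi a θ B T p n s.toNNReal ω) -
      meanPower B P p * ∫ s in (0 : ℝ)..t, ratio a θ p s.toNNReal ω| ≤ 6 * ε := by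
  have hmono : Monotone fun k => (gridPoint θ T n k ω : ℝ) := fun i j hij =>
    NNReal.coe_le_coe.2 (monotone_gridPoint θ T n ω hij)
  have hδ : ∀ k, (cellLength θ T n k ω : ℝ) ≤ d := fun k => (hctrl k k le_rfl).2.2
  have hr : ∀ k, |ratio a θ p (gridPoint θ T n k ω) ω| ≤ C := fun k => (hctrl k k le_rfl).2.1
  have hE01 : 0 ≤ meanPower B P p ∧ meanPower B P p ≤ 1 := by
    rcases hp with rfl | rfl
    · rw [meanPower_one hB]; norm_num
    · rw [meanPower_two hB]; norm_num
  have hcell : ∀ k, ∫ u in (gridPoint θ T n k ω : ℝ)..(gridPoint θ T n (k + 1) ω),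
      psi a θ B T p n u.toNNReal ω = weight a θ T p n C d k ω *
        cellIntegral B p (gridPoint θ T n k) (cellLength θ T n k) ω := fun k => by
    rw [integral_psi_cell k ω ⟨hmono (Nat.le_succ k), le_rfl⟩, weight_of_mem (hctrl k),
      cellLength_eq_sub]
    rfl
  have key := abs_primitive_sub_le (t := fun k => (gridPoint θ T n k ω : ℝ)) (T := T)
    (e := meanPower B P p) (ψ := fun s => psi a θ B T p n s.toNNReal ω)
    (f := fun s => ratio a θ p s.toNNReal ω)
    (m := fun k => weight a θ T p n C d k ω *
      (meanPower B P p * (cellLength θ T n k ω : ℝ) ^ p))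
    (ε₁ := ε) (ε₂ := ε) (ε₃ := ε) (ε₄ := ε) (ε₅ := ε) hmono (by simp [gridPoint])
    (fun k => NNReal.coe_le_coe.2 (gridPoint_le θ T n k ω)) hE01.1 hE01.2
    (intervalIntegrable_psi hB.continuous_paths hab) (intervalIntegrable_ratio ha hθ hR)
    ?_ (fun s hs _ => psi_eq_zero hs) ?_ ?_ ?_ hS hε ?_ ht.1 ht.2
  -- All five errors are taken equal to `ε`; the step error counts twice, whence `6 * ε`.
  · linarith
  · refine intervalIntegrable_of_bounded (M := C) T.coe_nonneg
      ((measurable_cellFun_ratio ha hθ T p n).comp (measurable_prodMk_right (y := ω)))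
      (fun s _ => rfl) fun s hs => ?_
    refine abs_cellFun_le hmono (by simpa [gridPoint] using hs.1) hC fun k _ => ?_
    simpa using hr k
  · intro K
    refine le_of_eq_of_le (congrArg _ (Finset.sum_congr rfl fun k _ => ?_)) (hM K)
    rw [hcell, compensatedCell, mul_sub]
  · intro k s hs
    have hs' : s - gridPoint θ T n k ω ≤ cellLength θ T n k ω := by
      rw [← cellLength_eq_sub]
      linarith [hs.2]
    have h := sq_integral_increment_le hB p (gridPoint θ T n k) (cellLength θ T n k) ω
      (sub_nonneg.2 hs.1) hs'
    rw [integral_psi_cell k ω hs, ← weight_of_mem (hctrl k)]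
    refine abs_le_of_sq_le_sq ?_ hε
    rw [mul_pow]
    refine (mul_le_mul_of_nonneg_left h (sq_nonneg _)).trans ?_
    rw [← mul_assoc]
    exact hE k
  · intro K
    refine (Finset.abs_sum_le_sum_abs _ _).trans ?_
    have h1 := sum_lastCell_le hn hθ_pos hC hδ K
    refine le_trans (Finset.sum_le_sum fun k _ => ?_) (h1.trans ?_)
    · simp only [Real.toNNReal_coe, cellLength_eq_sub]
      exact abs_compensator_sub_le hB hθ_pos hp hC (hctrl k)
    · split_ifs
      · exact hCd
      · exact hε
  · intro k
    simp only [Real.toNNReal_coe, cellLength_eq_sub]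
    exact (mul_le_mul (hr k) (hδ k) (NNReal.coe_nonneg _) hC).trans hCd

theorem tendstoUniformlyInProb_integral_psi [IsProbabilityMeasure P]
    (hB : IsFilteredBrownian B 𝓕 P) (hp : p = 1 ∨ p = 2)
    (ha : IsStronglyProgressive 𝓕 a) (hθ : IsStronglyProgressive 𝓕 θ)
    (hab : ∀ᵐ ω ∂P, ∃ C : ℝ, ∀ t ≤ T, |a t ω| ≤ C)
    (hθ_pos : ∀ ω, ∀ t ≤ T, 0 < θ t ω)
    (hR : ∀ᵐ ω ∂P, RiemannIntegrableOn (fun s => ratio a θ p s.toNNReal ω) 0 T)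
    (hη : ∀ t < T, TendstoInMeasure P
      (fun (n : ℕ) ω => lastGridPoint θ T n t ω) atTop (fun _ => t)) :
    TendstoUniformlyInProb P T
      (fun n t ω => ∫ s in (0 : ℝ)..t, psi a θ B T p n s.toNNReal ω)
      (fun t ω => meanPower B P p * ∫ s in (0 : ℝ)..t, ratio a θ p s.toNNReal ω) := by
  intro ε hε
  rw [ENNReal.tendsto_nhds_zero]
  intro κ₀ hκ₀
  -- A level `r` strictly below `ε` is needed because the event is `ε ≤ sup`. Six exceptional
  -- events, besides a null set, share the probability `κ₀`.
  obtain ⟨r, hr0, hrε⟩ := ENNReal.lt_iff_exists_nnreal_btwn.1 hε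
  obtain ⟨κ, hκ0, hκκ⟩ := ENNReal.lt_iff_exists_nnreal_btwn.1
    (ENNReal.div_pos hκ₀.ne' (by norm_num : (6 : ℝ≥0∞) ≠ ⊤))
  have hκR : (0 : ℝ) < κ := by exact_mod_cast hκ0
  set e : ℝ := r / 6 with he
  have he0 : 0 < e := by
    have : (0 : ℝ) < r := by exact_mod_cast hr0
    positivity
  have hle := fun n k => (gridFiltration hθ T n).le k
  obtain ⟨C₁, hC₁, hP₁⟩ := exists_measure_exists_gt_le (P := P)
    (Y := fun n k ω => a (gridPoint θ T n k ω) ω)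
    (fun n k => (measurable_gridPoint_value hθ T n k ha).mono (hle n k) le_rfl)
    (by
      filter_upwards [hab] with ω ⟨C, hC⟩
      exact ⟨C, fun n k => hC _ (gridPoint_le θ T n k ω)⟩) hκ0
  obtain ⟨C₂, hC₂, hP₂⟩ := exists_measure_exists_gt_le (P := P)
    (Y := fun n k ω => ratio a θ p (gridPoint θ T n k ω) ω)
    (fun n k => (measurable_gridPoint_ratio ha hθ T p n k).mono (hle n k) le_rfl)
    (by
      filter_upwards [hR] with ω hω
      obtain ⟨⟨M, hM⟩, -⟩ := hω
      refine ⟨M, fun n k => ?_⟩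
      simpa using hM (gridPoint θ T n k ω) ⟨NNReal.coe_nonneg _,
        NNReal.coe_le_coe.2 (gridPoint_le θ T n k ω)⟩) hκ0
  obtain ⟨δ, hδ0, hP₃⟩ := exists_measure_stepError_le ha hθ hR he0 hκ0
  set C := max C₁ C₂ with hCdef
  have hC : 0 ≤ C := hC₁.trans (le_max_left _ _)
  set c := gaussMoment (2 * p) 1 with hc
  have hc0 : 0 ≤ c := gaussMoment_two_mul_nonneg p 1
  set A : ℝ := 2 * (c + 1) * C ^ 2 * T with hA
  have hA0 : 0 ≤ A := by positivity
  -- The mesh is chosen after `C`: the three entries serve the Riemann step error, the single-cell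
  -- terms `C * d`, and the two probability bounds. The `+ 1` avoids division by zero.
  set d : ℝ := min δ (min (e / (C + 1)) (κ * e ^ 2 / (A + 1))) with hd
  have hd0 : 0 < d := lt_min hδ0 (lt_min (by positivity) (by positivity))
  have hCd : C * d ≤ e := by
    have h1 : d ≤ e / (C + 1) := (min_le_right _ _).trans (min_le_left _ _)
    rw [le_div_iff₀ (by positivity)] at h1
    nlinarith
  have hAd : A * d ≤ κ * e ^ 2 := by
    have h1 : d ≤ κ * e ^ 2 / (A + 1) := (min_le_right _ _).trans (min_le_right _ _)
    rw [le_div_iff₀ (by positivity)] at h1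
    nlinarith
  have hP₄ : ∀ n, P {ω | ∃ K, e ≤ |∑ k ∈ Finset.range K, compensatedCell a θ B P T p n C d k ω|} ≤
      κ := fun n => by
    refine (measure_exists_le_abs_sum_compensatedCell hB ha hθ hθ_pos hp hC hd0.le n he0).trans ?_
    rw [← ENNReal.ofReal_coe_nnreal]
    refine ENNReal.ofReal_le_ofReal ?_
    rw [div_le_iff₀ (by positivity)]
    calc _ = A * d := by rw [hA]; ring
      _ ≤ _ := hAd
  have hP₅ : ∀ n, P {ω | ∃ k, e ^ 2 ≤ cellEnergy a θ B T p n C d k ω} ≤ κ := fun n => by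
    refine (measure_exists_le_cellEnergy hB ha hθ hθ_pos hC hd0.le n (by positivity)).trans ?_
    rw [← ENNReal.ofReal_coe_nnreal]
    refine ENNReal.ofReal_le_ofReal ?_
    rw [div_le_iff₀ (by positivity)]
    refine le_trans ?_ hAd
    have : 0 ≤ C ^ 2 * d * T := by positivity
    rw [hA]
    nlinarith
  filter_upwards [eventually_gt_atTop 0, ENNReal.tendsto_nhds_zero.1
    (tendsto_measure_compl_fineGridSet hη hd0) κ hκ0] with n hn hP₆
  have hN : P {ω | ¬ ((∃ C : ℝ, ∀ t ≤ T, |a t ω| ≤ C) ∧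
      RiemannIntegrableOn (fun s => ratio a θ p s.toNNReal ω) 0 T)} = 0 :=
    ae_iff.1 (hab.and hR)
  have hsub : {ω | ε ≤ ⨆ t ∈ Set.Icc (0 : ℝ) T,
      ‖(∫ s in (0 : ℝ)..t, psi a θ B T p n s.toNNReal ω) -
        meanPower B P p * ∫ s in (0 : ℝ)..t, ratio a θ p s.toNNReal ω‖ₑ} ⊆
      {ω | ¬ ((∃ C : ℝ, ∀ t ≤ T, |a t ω| ≤ C) ∧
        RiemannIntegrableOn (fun s => ratio a θ p s.toNNReal ω) 0 T)} ∪
      ({ω | ∃ n k, C₁ < |a (gridPoint θ T n k ω) ω|} ∪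
      ({ω | ∃ n k, C₂ < |ratio a θ p (gridPoint θ T n k ω) ω|} ∪
      ({ω | ∃ n, ∃ d ≤ δ, ω ∈ fineGridSet θ T n d ∧
        ENNReal.ofReal e < stepError a θ T p n ω} ∪
      ({ω | ∃ K, e ≤ |∑ k ∈ Finset.range K, compensatedCell a θ B P T p n C d k ω|} ∪
      ({ω | ∃ k, e ^ 2 ≤ cellEnergy a θ B T p n C d k ω} ∪ (fineGridSet θ T n d)ᶜ))))) := by
    intro ω hω
    by_contra hcon
    simp only [Set.mem_union, not_or, Set.mem_ofPred_eq, not_not, not_exists, not_lt, not_le,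
      Set.mem_compl_iff, not_and] at hcon
    obtain ⟨h₀, h₁, h₂, h₃, h₄, h₅, h₆⟩ := hcon
    have hω₁ := (Classical.not_imp.1 h₀).1
    have hω₂ := not_not.1 (Classical.not_imp.1 h₀).2
    have hctrl : ∀ k, ω ∈ controlSet a θ T p n C d k := fun k j _ =>
      ⟨(h₁ n j).trans (le_max_left _ _), (h₂ n j).trans (le_max_right _ _), h₆.1 j⟩
    have hbound : ∀ t ∈ Set.Icc (0 : ℝ) T,
        ‖(∫ s in (0 : ℝ)..t, psi a θ B T p n s.toNNReal ω) -
          meanPower B P p * ∫ s in (0 : ℝ)..t, ratio a θ p s.toNNReal ω‖ₑ ≤ r := by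
      intro t ht
      have h := abs_integral_psi_sub_le hB ha hθ hn hθ_pos hp hC he0.le hCd hω₂ hω₁ hctrl
        (fun K => (h₄ K).le) (fun k => (h₅ k).le) (h₃ n d (min_le_left _ _) h₆) ht
      rw [Real.enorm_eq_ofReal_abs, ← ENNReal.ofReal_coe_nnreal]
      refine ENNReal.ofReal_le_ofReal (h.trans_eq ?_)
      rw [he]
      ring
    exact absurd (hω.trans (iSup₂_le hbound)) (not_le.2 hrε)
  calc _ ≤ _ := measure_mono hsub
    _ ≤ 0 + (κ + (κ + (κ + (κ + (κ + κ))))) := by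
        refine (measure_union_le _ _).trans (add_le_add hN.le ?_)
        refine (measure_union_le _ _).trans (add_le_add hP₁ ?_)
        refine (measure_union_le _ _).trans (add_le_add hP₂ ?_)
        refine (measure_union_le _ _).trans (add_le_add hP₃ ?_)
        refine (measure_union_le _ _).trans (add_le_add (hP₄ n) ?_)
        exact (measure_union_le _ _).trans (add_le_add (hP₅ n) hP₆)
    _ = κ * 6 := by ring
    _ ≤ κ₀ / 6 * 6 := by gcongr
    _ = κ₀ := ENNReal.div_mul_cancel (by norm_num) (by norm_num)

end Convergence

end RandomGrid

end

theorem lemma2p8 {Ω : Type*} {mΩ : MeasurableSpace Ω} (P : Measure Ω) [IsProbabilityMeasure P]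
    (𝓕 : Filtration ℝ≥0 mΩ) (B : ℝ≥0 → Ω → ℝ)
    (hB : RandomGrid.IsFilteredBrownian B 𝓕 P)
    (T : ℝ≥0) (p : ℕ) (hp : p = 1 ∨ p = 2)
    (a θ : ℝ≥0 → Ω → ℝ)
    (ha : IsStronglyProgressive 𝓕 a) (hθ : IsStronglyProgressive 𝓕 θ)
    (ha_bdd : RandomGrid.LocallyBoundedOn a 𝓕 P T)
    (hθ_pos : ∀ ω, ∀ t ≤ T, 0 < θ t ω)
    (hR : ∀ᵐ ω ∂P, RandomGrid.RiemannIntegrableOn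
      (fun s => RandomGrid.ratio a θ p s.toNNReal ω) 0 T)
    (hη : ∀ t < T, TendstoInMeasure P
      (fun (n : ℕ) ω => RandomGrid.lastGridPoint θ T n t ω) atTop (fun _ => t)) :
    (RandomGrid.meanPower B P 1 = 0 ∧ RandomGrid.meanPower B P 2 = 1 / 2) ∧
    (∀ᵐ ω ∂P,
      (∀ n : ℕ, IntervalIntegrable
        (fun s => RandomGrid.psi a θ B T p n s.toNNReal ω) volume 0 T) ∧
      IntervalIntegrable (fun s => RandomGrid.ratio a θ p s.toNNReal ω) volume 0 T) ∧
    RandomGrid.TendstoUniformlyInProb P T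
      (fun n t ω => ∫ s in (0 : ℝ)..t, RandomGrid.psi a θ B T p n s.toNNReal ω)
      (fun t ω => RandomGrid.meanPower B P p *
        ∫ s in (0 : ℝ)..t, RandomGrid.ratio a θ p s.toNNReal ω) := by
  have hab := ha_bdd.ae_bounded
  refine ⟨⟨RandomGrid.meanPower_one hB, RandomGrid.meanPower_two hB⟩, ?_,
    RandomGrid.tendstoUniformlyInProb_integral_psi hB hp ha hθ hab hθ_pos hR hη⟩
  filter_upwards [hab, hR] with ω h₁ h₂
  exact ⟨fun n => RandomGrid.intervalIntegrable_psi hB.continuous_paths h₁,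
    RandomGrid.intervalIntegrable_ratio ha hθ h₂⟩
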